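/- Let $N\ge 2$ be an integer and $\alpha>-1$. Write the points of $\mathbb R^N=\mathbb R^{N-1}\times\mathbb R$ as $(x',\lambda)$, and put $$\mathcal H_1=\{(x',\lambda):|x'|<1\},\qquad \mathcal C_1=\{(x',\lambda):|x'|<1,\ |\lambda|<1\}.$$ For an open set $U\subset\mathbb R^N$, $C_0^\infty(U)$ denotes the real-valued smooth functions with compact support contained in $U$. For real $\sigma$, $Q\ge 2$ and $C>0$ consider the inequality $$\left(\int_{\mathcal C_1}(1-|\lambda|)^\alpha|f(x',\lambda)|^Q\,dx'\,d\lambda\right)^{2/Q}\le C\int_{\mathcal C_1}(1-|\lambda|)^\alpha\left(|\nabla_{x'}f|^2+(1-|\lambda|)^\sigma|\partial_\lambda f|^2\right)dx'\,d\lambda,\qquad(*)$$ where the integrals of nonnegative functions take values in $[0,\infty]$ (so $(*)$ holds trivially when the right side is $+\infty$). (i) Let $\sigma\in(-2\alpha,2)$ and $$2\le Q\le Q_{cr}(N,\alpha,\sigma):=\frac{2\left(N+\frac{2\alpha+\sigma}{2-\sigma}\right)}{N+\frac{2\alpha+\sigma}{2-\sigma}-2}.$$ Then there is a constant $C=C(Q,N,\alpha,\sigma)>0$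 such that $(*)$ holds for every $f\in C_0^\infty(\mathcal H_1)$; in particular, $f$ need not vanish at $\lambda=\pm1$. (ii) Let $\sigma=2$ and $Q=2$. Then there is a constant $C=C(N,\alpha)>0$ such that $(*)$ holds for every $f\in C_0^\infty(\mathcal H_1)$. (iii) Let $\sigma=2$ and $Q>2$. Then there is no constant $C>0$ such that $(*)$ holds for every $f\in C_0^\infty(\mathcal C_1)$. -/

import Mathlib

open MeasureTheory Set
open scoped ENNReal ContDiff

namespace AnisotropicSobolev

/-- The space `ℝ^{N-1} × ℝ` with points `(x', lam)`; the factor `ℝ^{N-1}` carries the Euclidean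
norm and `volume` is the Lebesgue measure `dx' dlam`. -/
abbrev Space (N : ℕ) : Type := EuclideanSpace ℝ (Fin (N - 1)) × ℝ

/-- The infinite cylinder `{(x', lam) : |x'| < 1}`. -/
def infiniteCylinder (N : ℕ) : Set (Space N) := {p | ‖p.1‖ < 1}

/-- The finite cylinder `{(x', lam) : |x'| < 1, |lam| < 1}`. -/
def finiteCylinder (N : ℕ) : Set (Space N) := {p | ‖p.1‖ < 1 ∧ |p.2| < 1}

/-- `f ∈ C_0^∞(U)`: smooth, with compact support contained in the open set `U`
(extended by zero to the whole space). -/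
structure IsTestFunction {N : ℕ} (U : Set (Space N)) (f : Space N → ℝ) : Prop where
  contDiff : ContDiff ℝ ∞ f
  hasCompactSupport : HasCompactSupport f
  tsupport_subset : tsupport f ⊆ U

/-- The partial gradient of `f` in the `x'` variables. -/
noncomputable def gradX {N : ℕ} (f : Space N → ℝ) (p : Space N) :
    EuclideanSpace ℝ (Fin (N - 1)) :=
  gradient (fun y => f (y, p.2)) p.1

/-- The partial derivative of `f` in the last variable. -/
noncomputable def derivLam {N : ℕ} (f : Space N → ℝ) (p : Space N) : ℝ :=
  deriv (fun t => f (p.1, t)) p.2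

/-- `(∫_{C_1} (1-|lam|)^α |f|^Q dx' dlam)^{2/Q}`. -/
noncomputable def weightedNormSq {N : ℕ} (α Q : ℝ) (f : Space N → ℝ) : ℝ≥0∞ :=
  (∫⁻ p in finiteCylinder N, ENNReal.ofReal ((1 - |p.2|) ^ α * |f p| ^ Q)) ^ (2 / Q)

/-- `∫_{C_1} (1-|lam|)^α (|∇_{x'} f|² + (1-|lam|)^σ |∂_lam f|²) dx' dlam`, with value `∞`
when the (nonnegative) integrand is not integrable. -/
noncomputable def anisotropicEnergy {N : ℕ} (α σ : ℝ) (f : Space N → ℝ) : ℝ≥0∞ :=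
  ∫⁻ p in finiteCylinder N, ENNReal.ofReal
    ((1 - |p.2|) ^ α * (‖gradX f p‖ ^ 2 + (1 - |p.2|) ^ σ * |derivLam f p| ^ 2))

/-- The weighted anisotropic Sobolev inequality for `f`, with constant `C`. -/
def SobolevInequality {N : ℕ} (α σ Q C : ℝ) (f : Space N → ℝ) : Prop :=
  weightedNormSq α Q f ≤ ENNReal.ofReal C * anisotropicEnergy α σ f

/-- The critical exponent. -/
noncomputable def criticalExponent (N : ℕ) (α σ : ℝ) : ℝ :=
  2 * ((N : ℝ) + (2 * α + σ) / (2 - σ)) / ((N : ℝ) + (2 * α + σ) / (2 - σ) - 2)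

end AnisotropicSobolev

/-!
Throughout, `n = N - 1` is the number of horizontal directions, `s = 1 - |lam|` is the distance to
the edge, `b = α + σ / 2`, and `D = N + (2 * α + σ) / (2 - σ)` is the homogeneous dimension, so that
the critical exponent is `2 * D / (D - 2)`.

**The positive results.** At the critical exponent the inequality follows from its `L¹` version
`∫ s ^ α * F ^ (D / (D - 1)) ≤ C * M ^ (D / (D - 1))`, where `F ≥ 0` and
`M = ∫ s ^ α * (|∇ₓF| + s ^ (σ / 2) * |∂F| + F)`. Two bounds are interpolated
(`lintegral_edgeWeight_mul_rpow_le`).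

* Since `b > 0`, on every vertical line `s ^ b * F` is at most a constant times
  `∫ s ^ b * |∂F| + s ^ α * F`, and on every horizontal line `s ^ α * F ≤ ∫ s ^ α * |∇ₓF|`. The
  Loomis–Whitney argument (Mathlib's grid-lines lemma) then gives
  `∫ (s ^ b * F) ^ (1 / n) * s ^ α * F ≤ C * M ^ ((n + 1) / n)`
  (`lintegral_rpow_mul_le_of_line_bounds`).
* Hardy's inequality in `L¹`, which holds for every `b > 0` and needs no boundary condition at
  `lam = ±1`, gives `∫ s ^ (b - 1) * F ≤ C * M` (`exists_edgeWeight_bounds`).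

Hölder's inequality with the exponent `θ = n / (D - 1)` reproduces exactly the weight `s ^ α` and the
power `D / (D - 1)`. Taking `F = |f| ^ γ` with `γ = 2 * (D - 1) / (D - 2)`, the Cauchy–Schwarz
inequality turns this into the `L²` inequality with an additional term `∫ s ^ α * f ^ 2` on the right
(`exists_critical_bound`), which the Poincaré inequality in the horizontal directions removes
(`IsTestFunction.lintegral_sq_le`). Smaller `Q` follow from Hölder's inequality because `s ^ α` has
finite integral over the cylinder (`IsTestFunction.exists_rpow_le_rpow`). For `σ = 2` and `Q = 2` the
Poincaré inequality alone suffices.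

**The negative result.** For `σ = 2` the compression `1 - lam ↦ (1 - lam) / ε` multiplies both
`∫ s ^ α * |f| ^ Q` and the energy by `ε ^ (α + 1)`, so that for `Q > 2` the inequality fails for the
compressions of a fixed bump function as `ε → 0` (`not_exists_sobolevInequality_two`).
-/

open scoped NNReal Interval

namespace AnisotropicSobolev

/-! ### Powers of the distance to the edge of `(-1, 1)` -/

/-- The weight `(1 - |t|) ^ β` on `(-1, 1)`, extended by zero to the line. The extension makes every
integral over the finite cylinder an integral over the whole space. -/
noncomputable def edgeWeight (β t : ℝ) : ℝ≥0∞ :=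
  (Ioo (-1 : ℝ) 1).indicator (fun t => ENNReal.ofReal ((1 - |t|) ^ β)) t

lemma edgeWeight_of_lt {t : ℝ} (β : ℝ) (h : |t| < 1) :
    edgeWeight β t = ENNReal.ofReal ((1 - |t|) ^ β) := by
  rw [edgeWeight, indicator_of_mem]
  exact abs_lt.1 h

lemma edgeWeight_of_le {t : ℝ} (β : ℝ) (h : 1 ≤ |t|) : edgeWeight β t = 0 := by
  rw [edgeWeight, indicator_of_notMem]
  exact fun h' => absurd (abs_lt.2 h') (not_lt.2 h)

lemma measurable_edgeWeight (β : ℝ) : Measurable (edgeWeight β) := by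
  refine Measurable.indicator ?_ measurableSet_Ioo
  fun_prop

lemma edgeWeight_neg (β t : ℝ) : edgeWeight β (-t) = edgeWeight β t := by
  rcases lt_or_ge |t| 1 with h | h
  · rw [edgeWeight_of_lt β h, edgeWeight_of_lt β (by rwa [abs_neg]), abs_neg]
  · rw [edgeWeight_of_le β h, edgeWeight_of_le β (by rwa [abs_neg])]

lemma edgeWeight_ne_top (β t : ℝ) : edgeWeight β t ≠ ⊤ := by
  rcases lt_or_ge |t| 1 with h | h
  · rw [edgeWeight_of_lt β h]; exact ENNReal.ofReal_ne_top
  · rw [edgeWeight_of_le β h]; exact ENNReal.zero_ne_top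

lemma edgeWeight_add (β γ t : ℝ) : edgeWeight (β + γ) t = edgeWeight β t * edgeWeight γ t := by
  rcases lt_or_ge |t| 1 with h | h
  · rw [edgeWeight_of_lt _ h, edgeWeight_of_lt _ h, edgeWeight_of_lt _ h,
      Real.rpow_add (by linarith), ENNReal.ofReal_mul (Real.rpow_nonneg (by linarith) _)]
  · simp [edgeWeight_of_le _ h]

lemma edgeWeight_rpow (β t : ℝ) {q : ℝ} (hq : 0 < q) :
    edgeWeight β t ^ q = edgeWeight (β * q) t := by
  rcases lt_or_ge |t| 1 with h | h
  · rw [edgeWeight_of_lt _ h, edgeWeight_of_lt _ h, Real.rpow_mul (by linarith),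
      ENNReal.ofReal_rpow_of_nonneg (Real.rpow_nonneg (by linarith) _) hq.le]
  · simp [edgeWeight_of_le _ h, hq]

lemma edgeWeight_anti {β r t : ℝ} (hβ : 0 ≤ β) (h : |r| ≤ |t|) :
    edgeWeight β t ≤ edgeWeight β r := by
  rcases lt_or_ge |t| 1 with ht | ht
  · rw [edgeWeight_of_lt _ ht, edgeWeight_of_lt _ (h.trans_lt ht)]
    exact ENNReal.ofReal_le_ofReal (Real.rpow_le_rpow (by linarith) (by linarith) hβ)
  · simp [edgeWeight_of_le _ ht]

lemma edgeWeight_le_one {β : ℝ} (hβ : 0 ≤ β) (t : ℝ) : edgeWeight β t ≤ 1 := by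
  refine (edgeWeight_anti hβ (r := 0) (by simp)).trans ?_
  rw [edgeWeight_of_lt _ (by simp)]
  simp

/-- Away from the edge, all the weights are bounded below. -/
lemma one_le_edgeWeight_mul (β : ℝ) {t : ℝ} (ht : |t| ≤ 1 / 2) :
    1 ≤ ENNReal.ofReal (2 ^ |β|) * edgeWeight β t := by
  rw [edgeWeight_of_lt _ (by linarith), ← ENNReal.ofReal_mul (by positivity),
    ENNReal.one_le_ofReal]
  have h0 := abs_nonneg t
  rcases le_or_gt 0 β with hβ | hβ
  · rw [abs_of_nonneg hβ, ← Real.mul_rpow (by norm_num) (by linarith)]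
    exact Real.one_le_rpow (by linarith) hβ
  · have h1 : (1 : ℝ) ≤ 2 ^ |β| := Real.one_le_rpow (by norm_num) (abs_nonneg _)
    have h2 : (1 : ℝ) ≤ (1 - |t|) ^ β :=
      Real.one_le_rpow_of_pos_of_le_one_of_nonpos (by linarith) (by linarith) hβ.le
    nlinarith

lemma lintegral_Ici_edgeWeight_le {b r : ℝ} (hb : 0 < b) (hr : 0 ≤ r) :
    ∫⁻ t in Ici r, edgeWeight (b - 1) t ≤ ENNReal.ofReal b⁻¹ * edgeWeight b r := by
  rcases lt_or_ge r 1 with h1 | h1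
  swap
  · rw [setLIntegral_congr_fun (g := 0) measurableSet_Ici
      (fun t (ht : r ≤ t) => edgeWeight_of_le _ (h1.trans (ht.trans (le_abs_self t))))]
    simp
  have hint : IntervalIntegrable (fun t : ℝ => (1 - t) ^ (b - 1)) volume r 1 := by
    have := (intervalIntegral.intervalIntegrable_rpow' (a := 1 - r) (b := 0)
      (r := b - 1) (by linarith)).comp_sub_left 1
    simpa using this
  have hval : ∫ t in r..1, (1 - t) ^ (b - 1) = b⁻¹ * (1 - r) ^ b := by
    rw [intervalIntegral.integral_comp_sub_left (fun t => t ^ (b - 1)), sub_self,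
      integral_rpow (Or.inl (by linarith)), sub_add_cancel, Real.zero_rpow hb.ne', sub_zero,
      div_eq_inv_mul]
  rw [edgeWeight_of_lt _ (by rwa [abs_of_nonneg hr]), abs_of_nonneg hr,
    ← ENNReal.ofReal_mul (by positivity), ← hval, intervalIntegral.integral_of_le h1.le,
    ofReal_integral_eq_lintegral_ofReal
      ((intervalIntegrable_iff_integrableOn_Ioc_of_le h1.le).1 hint)
      ((ae_restrict_iff' measurableSet_Ioc).2 (.of_forall fun t ht =>
        Real.rpow_nonneg (by linarith [ht.2]) _)),
    ← lintegral_indicator measurableSet_Ici, ← lintegral_indicator measurableSet_Ioc]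
  refine lintegral_mono_ae ?_
  filter_upwards [compl_mem_ae_iff.2 (measure_singleton r)] with t htr
  by_cases ht : t ∈ Ici r
  · rw [indicator_of_mem ht]
    have ht0 : 0 ≤ t := hr.trans ht
    rcases lt_or_ge t 1 with ht1 | ht1
    · rw [indicator_of_mem (show t ∈ Ioc r 1 from ⟨lt_of_le_of_ne ht (Ne.symm htr), ht1.le⟩),
        edgeWeight_of_lt _ (by rwa [abs_of_nonneg ht0]), abs_of_nonneg ht0]
    · rw [edgeWeight_of_le _ (by rwa [abs_of_nonneg ht0])]
      exact zero_le
  · rw [indicator_of_notMem ht]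
    exact zero_le

lemma lintegral_Iic_edgeWeight_le {b r : ℝ} (hb : 0 < b) (hr : r ≤ 0) :
    ∫⁻ t in Iic r, edgeWeight (b - 1) t ≤ ENNReal.ofReal b⁻¹ * edgeWeight b r := by
  have h := lintegral_Ici_edgeWeight_le hb (neg_nonneg.2 hr)
  rw [edgeWeight_neg] at h
  refine le_of_eq_of_le ?_ h
  rw [← lintegral_indicator measurableSet_Ici, ← lintegral_indicator measurableSet_Iic,
    ← lintegral_neg_eq_self]
  refine lintegral_congr fun t => ?_
  simp only [indicator, mem_Iic, mem_Ici, edgeWeight_neg, neg_le]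

lemma lintegral_edgeWeight_le {b : ℝ} (hb : 0 < b) :
    ∫⁻ t, edgeWeight (b - 1) t ≤ 2 * ENNReal.ofReal b⁻¹ := by
  have h0 : ∀ c, c * edgeWeight b 0 ≤ c := fun c =>
    mul_le_of_le_one_right' (edgeWeight_le_one hb.le 0)
  rw [← setLIntegral_univ, ← Iic_union_Ici (a := (0 : ℝ)), two_mul]
  exact (lintegral_union_le _ _ _).trans (add_le_add
    ((lintegral_Iic_edgeWeight_le hb le_rfl).trans (h0 _))
    ((lintegral_Ici_edgeWeight_le hb le_rfl).trans (h0 _)))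

/-! ### One-dimensional weighted inequalities -/

/-- `d` is an upper gradient of `F`: it controls the increments of `F` over every interval.
This is all that is used of the derivative. -/
def IsUpperGradient (F d : ℝ → ℝ≥0∞) : Prop :=
  ∀ r t, F t ≤ F r + ∫⁻ y in Ι r t, d y

/-- The value in the middle is controlled because there all the weights are comparable to `1`. -/
lemma IsUpperGradient.apply_zero_le (α b : ℝ) {F d : ℝ → ℝ≥0∞} (h : IsUpperGradient F d)
    (hd : Measurable d) :
    F 0 ≤ (2 * ENNReal.ofReal (2 ^ |α|) + ENNReal.ofReal (2 ^ |b|)) *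
      ((∫⁻ t, edgeWeight α t * F t) + ∫⁻ t, edgeWeight b t * d t) := by
  set A := ∫⁻ t, edgeWeight α t * F t
  set B := ∫⁻ t, edgeWeight b t * d t
  set p := ENNReal.ofReal (2 ^ |α|)
  set q := ENNReal.ofReal (2 ^ |b|)
  have key : ∀ t ∈ Ioc (0 : ℝ) (1 / 2), F 0 ≤ p * (edgeWeight α t * F t) + q * B := by
    intro t ht
    have ht' : |t| ≤ 1 / 2 := by rw [abs_of_pos ht.1]; exact ht.2
    refine (h t 0).trans (add_le_add ?_ ?_)
    · rw [← mul_assoc]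
      exact le_mul_of_one_le_left' (one_le_edgeWeight_mul α ht')
    · rw [uIoc_comm, uIoc_of_le ht.1.le, ← lintegral_const_mul' q _ ENNReal.ofReal_ne_top]
      refine (setLIntegral_mono_ae (g := fun t => q * (edgeWeight b t * d t))
        ?_ ?_).trans (setLIntegral_le_lintegral _ _)
      · exact (((measurable_edgeWeight b).mul hd).const_mul _).aemeasurable
      · refine .of_forall fun y hy => ?_
        rw [← mul_assoc]
        refine le_mul_of_one_le_left' (one_le_edgeWeight_mul b ?_)
        rw [abs_of_pos hy.1]
        exact hy.2.trans ht.2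
  have hv : volume (Ioc (0 : ℝ) (1 / 2)) = 2⁻¹ := by
    rw [Real.volume_Ioc, sub_zero, one_div, ENNReal.ofReal_inv_of_pos (by norm_num)]
    simp
  have hI : F 0 * 2⁻¹ ≤ p * A + q * B * 2⁻¹ := by
    calc F 0 * 2⁻¹ = ∫⁻ _ in Ioc (0 : ℝ) (1 / 2), F 0 := by rw [setLIntegral_const, hv]
      _ ≤ ∫⁻ t in Ioc (0 : ℝ) (1 / 2), (p * (edgeWeight α t * F t) + q * B) :=
        setLIntegral_mono' measurableSet_Ioc key
      _ = (∫⁻ t in Ioc (0 : ℝ) (1 / 2), p * (edgeWeight α t * F t)) + q * B * 2⁻¹ := by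
        rw [lintegral_add_right _ measurable_const, setLIntegral_const, hv]
      _ ≤ p * A + q * B * 2⁻¹ := by
        gcongr
        rw [lintegral_const_mul' _ _ ENNReal.ofReal_ne_top]
        gcongr
        exact setLIntegral_le_lintegral _ _
  have h2 : ∀ x : ℝ≥0∞, x * 2⁻¹ * 2 = x := fun x => by
    rw [mul_assoc, ENNReal.inv_mul_cancel two_ne_zero ENNReal.ofNat_ne_top, mul_one]
  calc F 0 = F 0 * 2⁻¹ * 2 := (h2 _).symm
    _ ≤ (p * A + q * B * 2⁻¹) * 2 := by gcongr
    _ = 2 * p * A + q * B := by rw [add_mul, h2]; ring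
    _ ≤ 2 * p * A + q * B + (2 * p * B + q * A) := le_self_add
    _ = _ := by ring

lemma IsUpperGradient.edgeWeight_mul_le {b : ℝ} (hb : 0 ≤ b) {F d : ℝ → ℝ≥0∞}
    (h : IsUpperGradient F d) (hd : Measurable d) (t : ℝ) :
    edgeWeight b t * F t ≤ F 0 + ∫⁻ y, edgeWeight b y * d y := by
  calc edgeWeight b t * F t ≤ edgeWeight b t * (F 0 + ∫⁻ y in Ι 0 t, d y) := by
        gcongr; exact h 0 t
    _ = edgeWeight b t * F 0 + ∫⁻ y in Ι 0 t, edgeWeight b t * d y := by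
        rw [mul_add, lintegral_const_mul _ hd]
    _ ≤ F 0 + ∫⁻ y in Ι 0 t, edgeWeight b y * d y := by
        refine add_le_add (mul_le_of_le_one_left' (edgeWeight_le_one hb t)) ?_
        refine setLIntegral_mono ((measurable_edgeWeight b).mul hd) fun y hy => ?_
        gcongr
        refine edgeWeight_anti hb ?_
        simpa using abs_sub_left_of_mem_uIcc (uIoc_subset_uIcc hy)
    _ ≤ _ := by gcongr; exact Measure.restrict_le_self

/-- Hardy's inequality in `L¹`: it has no critical exponent, so it holds for every `b > 0`. -/
lemma IsUpperGradient.lintegral_edgeWeight_sub_one_mul_le {b : ℝ} (hb : 0 < b) {F d : ℝ → ℝ≥0∞}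
    (h : IsUpperGradient F d) (hd : Measurable d) :
    ∫⁻ t, edgeWeight (b - 1) t * F t ≤
      2 * ENNReal.ofReal b⁻¹ * (F 0 + ∫⁻ y, edgeWeight b y * d y) := by
  have hS : MeasurableSet {p : ℝ × ℝ | p.2 ∈ Ι 0 p.1} := by
    have : {p : ℝ × ℝ | p.2 ∈ Ι 0 p.1} = {p | min 0 p.1 < p.2 ∧ p.2 ≤ max 0 p.1} := by
      ext p; simp [uIoc]
    rw [this]
    exact (measurableSet_lt (measurable_const.min measurable_fst) measurable_snd).inter
      (measurableSet_le measurable_snd (measurable_const.max measurable_fst))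
  set K : ℝ → ℝ → ℝ≥0∞ := fun t y =>
    {p : ℝ × ℝ | p.2 ∈ Ι 0 p.1}.indicator (fun p => edgeWeight (b - 1) p.1 * d p.2) (t, y)
  have hK : Measurable (Function.uncurry K) :=
    (((measurable_edgeWeight _).comp measurable_fst).mul (hd.comp measurable_snd)).indicator hS
  -- By Tonelli, `d y` is integrated against the mass of `(1 - |t|) ^ (b - 1)` beyond `y`.
  have hinner : ∀ y, ∫⁻ t, K t y ≤ 2 * ENNReal.ofReal b⁻¹ * (edgeWeight b y * d y) := by
    intro y
    have haux : ∫⁻ t, {p : ℝ × ℝ | p.2 ∈ Ι 0 p.1}.indicator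
        (fun p => edgeWeight (b - 1) p.1) (t, y) ≤ ENNReal.ofReal b⁻¹ * edgeWeight b y := by
      rcases lt_or_ge 0 y with hy | hy
      · refine le_trans ?_ (lintegral_Ici_edgeWeight_le hb hy.le)
        rw [← lintegral_indicator measurableSet_Ici]
        refine lintegral_mono fun t => ?_
        by_cases ht : y ∈ Ι 0 t
        · have : y ≤ t := by
            rcases mem_uIoc.1 ht with h' | h'
            · exact h'.2
            · linarith [h'.2]
          simp [indicator, ht, this]
        · simp [indicator, ht]
      · refine le_trans ?_ (lintegral_Iic_edgeWeight_le hb hy)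
        rw [← lintegral_indicator measurableSet_Iic]
        refine lintegral_mono fun t => ?_
        by_cases ht : y ∈ Ι 0 t
        · have : t ≤ y := by
            rcases mem_uIoc.1 ht with h' | h'
            · linarith [h'.1]
            · exact h'.1.le
          simp [indicator, ht, this]
        · simp [indicator, ht]
    calc ∫⁻ t, K t y = ∫⁻ t, {p : ℝ × ℝ | p.2 ∈ Ι 0 p.1}.indicator
          (fun p => edgeWeight (b - 1) p.1) (t, y) * d y := by
          refine lintegral_congr fun t => ?_
          simp only [K, indicator]
          split_ifs <;> simp
      _ ≤ ENNReal.ofReal b⁻¹ * edgeWeight b y * d y := by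
          rw [lintegral_mul_const]
          · gcongr
          · exact (((measurable_edgeWeight _).comp measurable_fst).indicator hS).comp
              measurable_prodMk_right
      _ ≤ 2 * (ENNReal.ofReal b⁻¹ * edgeWeight b y * d y) :=
          le_mul_of_one_le_left' one_le_two
      _ = _ := by ring
  calc ∫⁻ t, edgeWeight (b - 1) t * F t
      ≤ ∫⁻ t, (edgeWeight (b - 1) t * F 0 + ∫⁻ y, K t y) := by
        refine lintegral_mono fun t => ?_
        refine (mul_le_mul_right (h 0 t) _).trans ?_
        rw [mul_add, ← lintegral_const_mul _ hd, ← lintegral_indicator measurableSet_uIoc]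
        rfl
    _ = (∫⁻ t, edgeWeight (b - 1) t) * F 0 + ∫⁻ y, ∫⁻ t, K t y := by
        rw [lintegral_add_left ((measurable_edgeWeight _).mul_const _),
          lintegral_mul_const _ (measurable_edgeWeight _),
          lintegral_lintegral_swap hK.aemeasurable]
    _ ≤ 2 * ENNReal.ofReal b⁻¹ * F 0 + ∫⁻ y, 2 * ENNReal.ofReal b⁻¹ * (edgeWeight b y * d y) := by
        refine add_le_add ?_ (lintegral_mono hinner)
        gcongr
        exact lintegral_edgeWeight_le hb
    _ = _ := by
        rw [lintegral_const_mul' _ _ (by finiteness), mul_add]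

/-- The two one-dimensional inequalities behind the weighted Sobolev inequality: a pointwise bound
and a Hardy bound, for functions that need not vanish anywhere. -/
lemma exists_edgeWeight_bounds (α : ℝ) {b : ℝ} (hb : 0 < b) :
    ∃ C : ℝ≥0, ∀ F d : ℝ → ℝ≥0∞, IsUpperGradient F d → Measurable d →
      (∀ t, edgeWeight b t * F t ≤
        C * ((∫⁻ t, edgeWeight α t * F t) + ∫⁻ t, edgeWeight b t * d t)) ∧
      ∫⁻ t, edgeWeight (b - 1) t * F t ≤
        C * ((∫⁻ t, edgeWeight α t * F t) + ∫⁻ t, edgeWeight b t * d t) := by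
  set c : ℝ≥0∞ := 2 * ENNReal.ofReal (2 ^ |α|) + ENNReal.ofReal (2 ^ |b|) + 1
  set e : ℝ≥0∞ := 2 * ENNReal.ofReal b⁻¹ + 1
  have hc : c ≠ ⊤ := by finiteness
  have he : e ≠ ⊤ := by finiteness
  refine ⟨(e * c).toNNReal, fun F d h hd => ?_⟩
  rw [ENNReal.coe_toNNReal (ENNReal.mul_ne_top he hc)]
  set X := (∫⁻ t, edgeWeight α t * F t) + ∫⁻ t, edgeWeight b t * d t
  have h0 : F 0 + ∫⁻ t, edgeWeight b t * d t ≤ c * X := by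
    simp only [c]
    rw [add_mul, one_mul]
    exact add_le_add (h.apply_zero_le α b hd) le_add_self
  have he1 : 1 ≤ e := le_add_self
  refine ⟨fun t => ?_, ?_⟩
  · refine ((h.edgeWeight_mul_le hb.le hd t).trans h0).trans ?_
    rw [mul_assoc]
    exact le_mul_of_one_le_left' he1
  · refine (h.lintegral_edgeWeight_sub_one_mul_le hb hd).trans ?_
    rw [mul_assoc e]
    exact mul_le_mul' le_self_add h0

end AnisotropicSobolev

namespace AnisotropicSobolev

/-! ### The Loomis–Whitney argument with weights -/

/-- Lines parallel to the axes: if `A` is bounded by the integral of `φ` along the vertical lines and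
`B` by the integrals of `φ` along the lines in each of the `n` horizontal directions, then
the product `A ^ (1 / n) * B` has the integrability of Gagliardo and Nirenberg. -/
lemma lintegral_rpow_mul_le_of_line_bounds {n : ℕ} (hn : 0 < n)
    {φ A B : EuclideanSpace ℝ (Fin n) × ℝ → ℝ≥0∞} (hφ : Measurable φ) (hA : Measurable A)
    (hB : Measurable B) (hAφ : ∀ x t, A (x, t) ≤ ∫⁻ r, φ (x, r))
    (hBφ : ∀ i x t, B (x, t) ≤ ∫⁻ y : ℝ, φ (x + y • EuclideanSpace.single i (1 : ℝ), t)) :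
    ∫⁻ p, A p ^ (1 / n : ℝ) * B p ≤ (∫⁻ p, φ p) ^ ((n + 1) / n : ℝ) := by
  have hn' : (0 : ℝ) < n := by exact_mod_cast hn
  set Ψ : (Fin (n + 1) → ℝ) → EuclideanSpace ℝ (Fin n) × ℝ :=
    fun z => (WithLp.toLp 2 (fun j => z j.succ), z 0)
  have hΨ : MeasurePreserving Ψ :=
    ((PiLp.volume_preserving_toLp (Fin n)).prod (MeasurePreserving.id volume)).comp
      (Measure.measurePreserving_swap.comp
        (volume_preserving_piFinSuccAbove (fun _ : Fin (n + 1) => ℝ) 0))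
  have hcoord : ∀ z, A (Ψ z) ^ (1 / n : ℝ) * B (Ψ z) ≤
      ∏ i, (∫⁻ y, φ (Ψ (Function.update z i y))) ^ (1 / n : ℝ) := by
    intro z
    rw [Fin.prod_univ_succ]
    refine mul_le_mul' ?_ ?_
    · gcongr
      refine (hAφ _ _).trans (le_of_eq (lintegral_congr fun y => ?_))
      simp [Ψ]
    · calc B (Ψ z) = ∏ _i : Fin n, B (Ψ z) ^ (1 / n : ℝ) := by
            rw [Finset.prod_const, Finset.card_univ, Fintype.card_fin, ← ENNReal.rpow_natCast,
              ← ENNReal.rpow_mul, one_div_mul_cancel hn'.ne', ENNReal.rpow_one]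
        _ ≤ _ := by
            refine Finset.prod_le_prod' fun i _ => ?_
            gcongr
            refine (hBφ i _ _).trans (le_of_eq ?_)
            rw [← lintegral_sub_right_eq_self _ (z i.succ)]
            refine lintegral_congr fun y => ?_
            congr 1
            refine Prod.ext ?_ ?_
            · ext j
              rcases eq_or_ne j i with rfl | hji
              · simp [Ψ]
              · simp [Ψ, hji]
            · simp [Ψ, Function.update_of_ne (Fin.succ_ne_zero i).symm]
  have hconj : Real.HolderConjugate (Fintype.card (Fin (n + 1))) ((n + 1) / n : ℝ) := by
    rw [Real.holderConjugate_iff]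
    simp only [Fintype.card_fin, Nat.cast_add, Nat.cast_one]
    constructor
    · linarith
    · field_simp
      ring
  have hgrid := lintegral_prod_lintegral_pow_le (fun _ : Fin (n + 1) => (volume : Measure ℝ)) hconj
    (hφ.comp hΨ.measurable)
  simp only [Fintype.card_fin, Nat.cast_add, Nat.cast_one, add_sub_cancel_right,
    Function.comp_apply] at hgrid
  rw [← volume_pi] at hgrid
  rw [← hΨ.lintegral_comp (f := fun p => A p ^ (1 / n : ℝ) * B p) ((hA.pow_const _).mul hB),
    ← hΨ.lintegral_comp hφ]
  exact (lintegral_mono hcoord).trans hgrid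

/-- The weighted Sobolev inequality in `L¹`, in terms of bounds along lines. Here
`b = α + σ / 2`, and `D` is the homogeneous dimension, so that `(D - n - 1) (1 - σ / 2) = b`. -/
lemma lintegral_edgeWeight_mul_rpow_le {n : ℕ} (hn : 0 < n) {α b D : ℝ} (hD : n + 1 < D)
    (hDb : (D - n - 1) * (1 + α - b) = b)
    {φ F : EuclideanSpace ℝ (Fin n) × ℝ → ℝ≥0∞} (hφ : Measurable φ) (hF : Measurable F)
    (hx : ∀ i x t, edgeWeight α t * F (x, t) ≤
      ∫⁻ y : ℝ, φ (x + y • EuclideanSpace.single i (1 : ℝ), t))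
    (ht : ∀ x t, edgeWeight b t * F (x, t) ≤ ∫⁻ r, φ (x, r))
    (hh : ∀ x, ∫⁻ t, edgeWeight (b - 1) t * F (x, t) ≤ ∫⁻ r, φ (x, r)) :
    ∫⁻ p, edgeWeight α p.2 * F p ^ (D / (D - 1)) ≤ (∫⁻ p, φ p) ^ (D / (D - 1)) := by
  have hn' : (0 : ℝ) < n := by exact_mod_cast hn
  have hD1 : 0 < D - 1 := by linarith
  have hw : ∀ β, Measurable fun p : EuclideanSpace ℝ (Fin n) × ℝ => edgeWeight β p.2 :=
    fun β => (measurable_edgeWeight β).comp measurable_snd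
  set G : EuclideanSpace ℝ (Fin n) × ℝ → ℝ≥0∞ :=
    fun p => (edgeWeight b p.2 * F p) ^ (1 / n : ℝ) * (edgeWeight α p.2 * F p)
  set H : EuclideanSpace ℝ (Fin n) × ℝ → ℝ≥0∞ := fun p => edgeWeight (b - 1) p.2 * F p
  have hGm : Measurable G := (((hw b).mul hF).pow_const _).mul ((hw α).mul hF)
  have hHm : Measurable H := (hw (b - 1)).mul hF
  have hG : ∫⁻ p, G p ≤ (∫⁻ p, φ p) ^ ((n + 1) / n : ℝ) :=
    lintegral_rpow_mul_le_of_line_bounds hn hφ ((hw b).mul hF) ((hw α).mul hF) ht hx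
  have hH : ∫⁻ p, H p ≤ ∫⁻ p, φ p := by
    rw [Measure.volume_eq_prod, lintegral_prod _ hHm.aemeasurable,
      lintegral_prod _ hφ.aemeasurable]
    exact lintegral_mono hh
  -- The exponent `θ` that interpolates between the two bounds.
  set θ : ℝ := n / (D - 1)
  have hθ0 : 0 < θ := div_pos hn' hD1
  have hθ1 : 0 < 1 - θ := by
    rw [sub_pos, div_lt_one hD1]; linarith
  have hexpF : 1 / n * θ + θ + (1 - θ) = D / (D - 1) := by
    simp only [θ]; field_simp; ring
  have hexpW : b * (1 / n * θ) + α * θ + (b - 1) * (1 - θ) = α := by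
    simp only [θ]; field_simp; linarith
  have hexpφ : (n + 1) / n * θ + (1 - θ) = D / (D - 1) := by
    simp only [θ]; field_simp; ring
  have hn1 : (0 : ℝ) < 1 / n * θ := by positivity
  have hpt : ∀ p, edgeWeight α p.2 * F p ^ (D / (D - 1)) = G p ^ θ * H p ^ (1 - θ) := by
    intro p
    simp only [G, H]
    rw [ENNReal.mul_rpow_of_nonneg _ _ hθ0.le, ← ENNReal.rpow_mul,
      ENNReal.mul_rpow_of_nonneg _ _ hn1.le, ENNReal.mul_rpow_of_nonneg _ _ hθ0.le,
      ENNReal.mul_rpow_of_nonneg _ _ hθ1.le, edgeWeight_rpow _ _ hn1, edgeWeight_rpow _ _ hθ0,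
      edgeWeight_rpow _ _ hθ1, ← hexpF, ENNReal.rpow_add_of_nonneg _ _ (by positivity) hθ1.le,
      ENNReal.rpow_add_of_nonneg _ _ hn1.le hθ0.le]
    conv_lhs => rw [← hexpW, edgeWeight_add, edgeWeight_add]
    ring
  calc ∫⁻ p, edgeWeight α p.2 * F p ^ (D / (D - 1)) = ∫⁻ p, G p ^ θ * H p ^ (1 - θ) :=
        lintegral_congr hpt
    _ ≤ (∫⁻ p, G p) ^ θ * (∫⁻ p, H p) ^ (1 - θ) :=
        ENNReal.lintegral_mul_norm_pow_le hGm.aemeasurable hHm.aemeasurable hθ0.le hθ1.le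
          (add_sub_cancel _ _)
    _ ≤ ((∫⁻ p, φ p) ^ ((n + 1) / n : ℝ)) ^ θ * (∫⁻ p, φ p) ^ (1 - θ) := by gcongr
    _ = (∫⁻ p, φ p) ^ (D / (D - 1)) := by
        rw [← ENNReal.rpow_mul, ← ENNReal.rpow_add_of_nonneg _ _ (by positivity) hθ1.le, hexpφ]

/-- The step from `L¹` to `L²`: a finite quantity `X` can be absorbed. -/
lemma rpow_le_mul_of_le_mul_rpow {X Y C : ℝ≥0∞} {κ : ℝ} (hκ : 0 < κ) (hκ2 : κ < 2) (hX : X ≠ ⊤)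
    (h : X ≤ (C * (X ^ (1 / 2 : ℝ) * Y ^ (1 / 2 : ℝ))) ^ κ) : X ^ (2 / κ - 1) ≤ C ^ 2 * Y := by
  have h2 : 0 < 2 / κ - 1 := by rw [sub_pos, lt_div_iff₀ hκ]; linarith
  rcases eq_or_ne X 0 with rfl | hX0
  · simp [h2]
  have h1 : X ^ (2 / κ) ≤ X * (C ^ 2 * Y) := by
    calc X ^ (2 / κ) ≤ ((C * (X ^ (1 / 2 : ℝ) * Y ^ (1 / 2 : ℝ))) ^ κ) ^ (2 / κ) :=
          ENNReal.rpow_le_rpow h (by positivity)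
      _ = (C * (X ^ (1 / 2 : ℝ) * Y ^ (1 / 2 : ℝ))) ^ (2 : ℝ) := by
          rw [← ENNReal.rpow_mul, mul_div_cancel₀ _ hκ.ne']
      _ = X * (C ^ 2 * Y) := by
          rw [ENNReal.mul_rpow_of_nonneg _ _ two_pos.le, ENNReal.mul_rpow_of_nonneg _ _ two_pos.le,
            ← ENNReal.rpow_mul, ← ENNReal.rpow_mul, one_div_mul_cancel two_ne_zero,
            ENNReal.rpow_one, ENNReal.rpow_one, ENNReal.rpow_two]
          ring
  rw [ENNReal.rpow_sub _ _ hX0 hX, ENNReal.rpow_one]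
  exact ENNReal.div_le_of_le_mul' h1

end AnisotropicSobolev

namespace AnisotropicSobolev

/-! ### Calculus along lines -/

/-- The fundamental theorem of calculus. -/
lemma isUpperGradient_of_contDiff {u : ℝ → ℝ} (hu : ContDiff ℝ 1 u) :
    IsUpperGradient (fun t => ENNReal.ofReal (u t)) fun t => ENNReal.ofReal |deriv u t| := by
  intro r t
  have hc : Continuous (deriv u) := hu.continuous_deriv le_rfl
  have h1 : u t = u r + ∫ y in r..t, deriv u y := by
    rw [intervalIntegral.integral_deriv_eq_sub
      (fun x _ => (hu.differentiable one_ne_zero).differentiableAt) (hc.intervalIntegrable _ _)]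
    ring
  have h2 : u t ≤ u r + ∫ y in Ι r t, |deriv u y| := by
    rw [h1]
    gcongr
    refine (le_abs_self _).trans ?_
    simpa using intervalIntegral.norm_integral_le_integral_norm_uIoc (f := deriv u) (a := r) (b := t)
      (μ := volume)
  have hint : Integrable (fun y => |deriv u y|) (volume.restrict (Ι r t)) :=
    (intervalIntegrable_iff.1 (hc.abs.intervalIntegrable r t))
  rw [← ofReal_integral_eq_lintegral_ofReal hint (.of_forall fun _ => abs_nonneg _)]
  exact (ENNReal.ofReal_le_ofReal h2).trans ENNReal.ofReal_add_le

lemma isUpperGradient_abs_rpow {g : ℝ → ℝ} (hg : ContDiff ℝ 1 g) {γ : ℝ} (hγ : 1 < γ) :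
    IsUpperGradient (fun t => ENNReal.ofReal (|g t| ^ γ))
      fun t => ENNReal.ofReal (γ * |g t| ^ (γ - 1) * |deriv g t|) := by
  have hu : ContDiff ℝ 1 fun t => |g t| ^ γ := (contDiff_norm_rpow (E := ℝ) hγ).comp hg
  convert isUpperGradient_of_contDiff hu using 3 with t
  have hd : HasDerivAt (fun t => |g t| ^ γ) (γ * |g t| ^ (γ - 2) * g t * deriv g t) t :=
    (hasDerivAt_abs_rpow (g t) hγ).comp t (hg.differentiable one_ne_zero t).hasDerivAt
  rw [hd.deriv, abs_mul, abs_mul, abs_mul, abs_of_pos (one_pos.trans hγ),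
    abs_of_nonneg (Real.rpow_nonneg (abs_nonneg _) _), mul_assoc γ (|g t| ^ (γ - 2))]
  congr 2
  rcases eq_or_ne (g t) 0 with h0 | h0
  · simp [h0, Real.zero_rpow (sub_pos.2 hγ).ne']
  · rw [← Real.rpow_add_one (abs_pos.2 h0).ne']
    congr 1; ring

variable {N : ℕ} {f : Space N → ℝ}

lemma IsTestFunction.contDiff_one {U : Set (Space N)} (hf : IsTestFunction U f) :
    ContDiff ℝ 1 f := hf.contDiff.of_le (by exact_mod_cast le_top)

lemma hasDerivAt_derivLam (hf : ContDiff ℝ 1 f) (p : Space N) :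
    HasDerivAt (fun t => f (p.1, t)) (derivLam f p) p.2 := by
  have : ContDiff ℝ 1 fun t => f (p.1, t) := hf.comp (contDiff_const.prodMk contDiff_id)
  exact (this.differentiable one_ne_zero p.2).hasDerivAt

lemma hasGradientAt_gradX (hf : ContDiff ℝ 1 f) (p : Space N) :
    HasGradientAt (fun x => f (x, p.2)) (gradX f p) p.1 := by
  have : ContDiff ℝ 1 fun x => f (x, p.2) := hf.comp (contDiff_id.prodMk contDiff_const)
  exact (this.differentiable one_ne_zero p.1).hasGradientAt

lemma continuous_derivLam (hf : ContDiff ℝ 1 f) : Continuous (derivLam f) := by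
  have h : derivLam f = fun p => fderiv ℝ f p (0, 1) := by
    ext p
    have h1 : HasDerivAt (fun t : ℝ => (p.1, t)) ((0 : EuclideanSpace ℝ (Fin (N - 1))), (1 : ℝ))
        p.2 := (hasDerivAt_const _ _).prodMk (hasDerivAt_id _)
    exact (((hf.differentiable one_ne_zero p).hasFDerivAt).comp_hasDerivAt p.2 h1).deriv
  rw [h]
  exact (hf.continuous_fderiv one_ne_zero).clm_apply continuous_const

lemma continuous_gradX (hf : ContDiff ℝ 1 f) : Continuous (gradX f) := by
  have h : gradX f = fun p => (InnerProductSpace.toDual ℝ _).symm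
      ((fderiv ℝ f p).comp (ContinuousLinearMap.inl ℝ (EuclideanSpace ℝ (Fin (N - 1))) ℝ)) := by
    ext1 p
    have h1 : HasFDerivAt (fun x : EuclideanSpace ℝ (Fin (N - 1)) => (x, p.2))
      (ContinuousLinearMap.inl ℝ (EuclideanSpace ℝ (Fin (N - 1))) ℝ) p.1 :=
      hasFDerivAt_prodMk_left _ _
    have h2 : HasFDerivAt (fun x => f (x, p.2)) _ p.1 :=
      ((hf.differentiable one_ne_zero p).hasFDerivAt).comp p.1 h1
    rw [gradX, gradient, h2.fderiv]
  rw [h]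
  exact (LinearIsometryEquiv.continuous _).comp
    ((hf.continuous_fderiv one_ne_zero).clm_comp continuous_const)

lemma gradX_eq_zero_of_notMem_tsupport {p : Space N} (hp : p ∉ tsupport f) : gradX f p = 0 := by
  have h : (fun x => f (x, p.2)) =ᶠ[nhds p.1] fun _ => 0 :=
    (Continuous.tendsto (f := fun x : EuclideanSpace ℝ (Fin (N - 1)) => (x, p.2))
      (by fun_prop) p.1).eventually (notMem_tsupport_iff_eventuallyEq.1 hp)
  rw [gradX, gradient, h.fderiv_eq]
  simp

lemma derivLam_eq_zero_of_notMem_tsupport {p : Space N} (hp : p ∉ tsupport f) :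
    derivLam f p = 0 := by
  have h : (fun t => f (p.1, t)) =ᶠ[nhds p.2] fun _ => 0 :=
    (Continuous.tendsto (f := fun t : ℝ => (p.1, t))
      (by fun_prop) p.2).eventually (notMem_tsupport_iff_eventuallyEq.1 hp)
  rw [derivLam, h.deriv_eq]
  simp

lemma IsTestFunction.notMem_tsupport (hf : IsTestFunction (infiniteCylinder N) f) {p : Space N}
    (hp : 1 ≤ ‖p.1‖) : p ∉ tsupport f := fun h => (hf.tsupport_subset h).not_ge hp

lemma IsTestFunction.eq_zero (hf : IsTestFunction (infiniteCylinder N) f) {p : Space N}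
    (hp : 1 ≤ ‖p.1‖) : f p = 0 := image_eq_zero_of_notMem_tsupport (hf.notMem_tsupport hp)

lemma IsTestFunction.gradX_eq_zero (hf : IsTestFunction (infiniteCylinder N) f) {p : Space N}
    (hp : 1 ≤ ‖p.1‖) : gradX f p = 0 := gradX_eq_zero_of_notMem_tsupport (hf.notMem_tsupport hp)

lemma IsTestFunction.derivLam_eq_zero (hf : IsTestFunction (infiniteCylinder N) f) {p : Space N}
    (hp : 1 ≤ ‖p.1‖) : derivLam f p = 0 :=
  derivLam_eq_zero_of_notMem_tsupport (hf.notMem_tsupport hp)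

/-- A function vanishing at the lateral boundary is bounded by the integral of its horizontal
gradient over any horizontal line. -/
lemma IsTestFunction.abs_rpow_le_lintegral_line (hf : IsTestFunction (infiniteCylinder N) f)
    {γ : ℝ} (hγ : 1 < γ) {v : EuclideanSpace ℝ (Fin (N - 1))} (hv : ‖v‖ = 1)
    (x : EuclideanSpace ℝ (Fin (N - 1))) (t : ℝ) :
    ENNReal.ofReal (|f (x, t)| ^ γ) ≤ ∫⁻ y : ℝ,
      ENNReal.ofReal (γ * |f (x + y • v, t)| ^ (γ - 1) * ‖gradX f (x + y • v, t)‖) := by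
  have hline : ContDiff ℝ 1 fun y : ℝ => x + y • v := by fun_prop
  have hg : ContDiff ℝ 1 fun y : ℝ => f (x + y • v, t) :=
    hf.contDiff_one.comp (hline.prodMk contDiff_const)
  -- A point of the line outside the cylinder.
  have hfar : f (x + (‖x‖ + 1) • v, t) = 0 := by
    refine hf.eq_zero ?_
    have h1 := norm_sub_norm_le ((‖x‖ + 1) • v) (-x)
    rw [norm_smul, hv, norm_neg, Real.norm_of_nonneg (by positivity), sub_neg_eq_add,
      add_comm _ x] at h1
    change 1 ≤ ‖x + (‖x‖ + 1) • v‖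
    linarith
  have h := isUpperGradient_abs_rpow hg hγ (‖x‖ + 1) 0
  simp only [hfar, zero_smul, add_zero, abs_zero, Real.zero_rpow (one_pos.trans hγ).ne',
    ENNReal.ofReal_zero, zero_add] at h
  refine h.trans ((setLIntegral_le_lintegral _ _).trans (lintegral_mono fun y => ?_))
  gcongr
  have hd : HasDerivAt (fun y : ℝ => x + y • v) v y := by
    simpa using ((hasDerivAt_id y).smul_const v).const_add x
  have hdf : HasDerivAt (fun y : ℝ => f (x + y • v, t))
      (InnerProductSpace.toDual ℝ _ (gradX f (x + y • v, t)) v) y :=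
    HasFDerivAt.comp_hasDerivAt (l := fun x => f (x, t)) y
      (hasGradientAt_gradX hf.contDiff_one (x + y • v, t)).hasFDerivAt hd
  rw [hdf.deriv, InnerProductSpace.toDual_apply_apply]
  simpa [hv] using abs_real_inner_le_norm (gradX f (x + y • v, t)) v

/-! ### Integrals over the finite cylinder -/

lemma measurableSet_finiteCylinder : MeasurableSet (finiteCylinder N) := by
  have h1 : IsOpen {p : Space N | ‖p.1‖ < 1} := isOpen_lt (by fun_prop) (by fun_prop)
  have h2 : IsOpen {p : Space N | |p.2| < 1} := isOpen_lt (by fun_prop) (by fun_prop)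
  exact (h1.inter h2).measurableSet

lemma setLIntegral_finiteCylinder (α : ℝ) {g : Space N → ℝ} (hg : ∀ p, 1 ≤ ‖p.1‖ → g p = 0) :
    ∫⁻ p in finiteCylinder N, ENNReal.ofReal ((1 - |p.2|) ^ α * g p) =
      ∫⁻ p, edgeWeight α p.2 * ENNReal.ofReal (g p) := by
  rw [← lintegral_indicator measurableSet_finiteCylinder]
  refine lintegral_congr fun p => ?_
  rcases lt_or_ge ‖p.1‖ 1 with h1 | h1
  · rcases lt_or_ge |p.2| 1 with h2 | h2
    · rw [indicator_of_mem (show p ∈ finiteCylinder N from ⟨h1, h2⟩), edgeWeight_of_lt _ h2,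
        ENNReal.ofReal_mul (Real.rpow_nonneg (by linarith) _)]
    · rw [indicator_of_notMem fun h => h.2.not_ge h2, edgeWeight_of_le _ h2, zero_mul]
  · rw [indicator_of_notMem fun h => h.1.not_ge h1, hg p h1, ENNReal.ofReal_zero, mul_zero]

/-- The mass of the finite cylinder is finite because `α > -1`. -/
lemma lintegral_edgeWeight_ball_lt_top {α : ℝ} (hα : -1 < α) :
    ∫⁻ p : Space N, edgeWeight α p.2 *
      (Metric.ball (0 : EuclideanSpace ℝ (Fin (N - 1))) 1).indicator 1 p.1 < ⊤ := by
  have hw : ∫⁻ t, edgeWeight α t < ⊤ := by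
    have := lintegral_edgeWeight_le (b := α + 1) (by linarith)
    rw [add_sub_cancel_right] at this
    exact this.trans_lt (by finiteness)
  have h := lintegral_prod_mul (μ := (volume : Measure (EuclideanSpace ℝ (Fin (N - 1)))))
    (ν := (volume : Measure ℝ)) (f := (Metric.ball 0 1).indicator 1) (g := edgeWeight α)
    ((measurable_one.indicator measurableSet_ball).aemeasurable)
    (measurable_edgeWeight α).aemeasurable
  simp only [mul_comm (edgeWeight α _)]
  rw [Measure.volume_eq_prod, h, lintegral_indicator_one measurableSet_ball]
  exact ENNReal.mul_lt_top measure_ball_lt_top hw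

lemma IsTestFunction.lintegral_abs_rpow_ne_top (hf : IsTestFunction (infiniteCylinder N) f)
    {α q : ℝ} (hα : -1 < α) (hq : 0 < q) :
    ∫⁻ p, edgeWeight α p.2 * ENNReal.ofReal (|f p| ^ q) ≠ ⊤ := by
  obtain ⟨M, hM⟩ := hf.contDiff.continuous.bounded_above_of_compact_support hf.hasCompactSupport
  refine ne_top_of_le_ne_top (ENNReal.mul_ne_top (ENNReal.ofReal_ne_top (r := M ^ q))
    (lintegral_edgeWeight_ball_lt_top (N := N) hα).ne) ?_
  rw [← lintegral_const_mul' _ _ ENNReal.ofReal_ne_top]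
  refine lintegral_mono fun p => ?_
  rcases lt_or_ge ‖p.1‖ 1 with h1 | h1
  · rw [indicator_of_mem (by simpa using h1), Pi.one_apply, mul_one, mul_comm]
    gcongr
    exact hM p
  · simp [hf.eq_zero h1, hq.ne']

/-- Hölder's inequality, for the finite measure with density `(1 - |lam|) ^ α` on the cylinder. -/
lemma IsTestFunction.exists_rpow_le_rpow {α q r : ℝ} (hα : -1 < α) (hq : 0 < q) (hqr : q ≤ r) :
    ∃ C : ℝ≥0, ∀ f : Space N → ℝ, IsTestFunction (infiniteCylinder N) f →
      (∫⁻ p, edgeWeight α p.2 * ENNReal.ofReal (|f p| ^ q)) ^ (2 / q) ≤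
        C * (∫⁻ p, edgeWeight α p.2 * ENNReal.ofReal (|f p| ^ r)) ^ (2 / r) := by
  have hr : 0 < r := hq.trans_le hqr
  set V := ∫⁻ p : Space N, edgeWeight α p.2 *
      (Metric.ball (0 : EuclideanSpace ℝ (Fin (N - 1))) 1).indicator 1 p.1
  have hV : V ≠ ⊤ := (lintegral_edgeWeight_ball_lt_top (N := N) hα).ne
  have he : 0 ≤ 1 - q / r := by rw [sub_nonneg]; exact (div_le_one hr).2 hqr
  have hqr0 : 0 < q / r := div_pos hq hr
  have hVe : (V ^ (1 - q / r)) ^ (2 / q) ≠ ⊤ := by finiteness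
  refine ⟨((V ^ (1 - q / r)) ^ (2 / q)).toNNReal, fun f hf => ?_⟩
  rw [ENNReal.coe_toNNReal hVe]
  set X := ∫⁻ p, edgeWeight α p.2 * ENNReal.ofReal (|f p| ^ r)
  have hw : Measurable fun p : Space N => edgeWeight α p.2 :=
    (measurable_edgeWeight α).comp measurable_snd
  have hfm : Measurable f := hf.contDiff.continuous.measurable
  have hpt : ∀ p : Space N, edgeWeight α p.2 * ENNReal.ofReal (|f p| ^ q) ≤
      (edgeWeight α p.2 * ENNReal.ofReal (|f p| ^ r)) ^ (q / r) * (edgeWeight α p.2 *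
      (Metric.ball (0 : EuclideanSpace ℝ (Fin (N - 1))) 1).indicator 1 p.1) ^ (1 - q / r) := by
    intro p
    rcases lt_or_ge ‖p.1‖ 1 with h1 | h1
    · rw [indicator_of_mem (by simpa using h1), Pi.one_apply, mul_one,
        ENNReal.mul_rpow_of_nonneg _ _ hqr0.le,
        ENNReal.ofReal_rpow_of_nonneg (by positivity) hqr0.le, ← Real.rpow_mul (abs_nonneg _),
        mul_div_cancel₀ _ hr.ne', mul_right_comm, ← ENNReal.rpow_add_of_nonneg _ _ hqr0.le he,
        add_sub_cancel, ENNReal.rpow_one]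
    · simp [hf.eq_zero h1, hq.ne']
  have hH : ∫⁻ p, edgeWeight α p.2 * ENNReal.ofReal (|f p| ^ q) ≤
      X ^ (q / r) * V ^ (1 - q / r) := by
    refine (lintegral_mono hpt).trans (ENNReal.lintegral_mul_norm_pow_le ?_ ?_ hqr0.le he
      (add_sub_cancel _ _))
    · exact (hw.mul (by fun_prop)).aemeasurable
    · exact (hw.mul ((measurable_one.indicator measurableSet_ball).comp
        measurable_fst)).aemeasurable
  calc _ ≤ (X ^ (q / r) * V ^ (1 - q / r)) ^ (2 / q) := by gcongr
    _ = _ := by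
      rw [ENNReal.mul_rpow_of_nonneg _ _ (by positivity), ← ENNReal.rpow_mul X, mul_comm]
      congr 2
      field_simp

end AnisotropicSobolev

namespace AnisotropicSobolev

/-! ### The Poincaré inequality in the horizontal directions -/

/-- Poincaré's inequality in `L¹`: only the line bound and the width of the ball matter. -/
lemma lintegral_le_two_mul_of_line_bound {n : ℕ} {v : EuclideanSpace ℝ (Fin n)} (hv : ‖v‖ = 1)
    {F G : EuclideanSpace ℝ (Fin n) → ℝ≥0∞} (hG : Measurable G)
    (hFG : ∀ x, F x ≤ ∫⁻ y : ℝ, G (x + y • v)) (hF : ∀ x, 1 ≤ ‖x‖ → F x = 0) :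
    ∫⁻ x, F x ≤ 2 * ∫⁻ x, G x := by
  set T : Set ℝ := Ioo (-1) 1
  have hT : Measurable (T.indicator (1 : ℝ → ℝ≥0∞)) := measurable_one.indicator measurableSet_Ioo
  have hm : Measurable fun p : EuclideanSpace ℝ (Fin n) × ℝ =>
      T.indicator (1 : ℝ → ℝ≥0∞) (inner ℝ p.1 v) * G (p.1 + p.2 • v) :=
    (hT.comp (by fun_prop)).mul (hG.comp (by fun_prop))
  have hm' : Measurable fun p : ℝ × EuclideanSpace ℝ (Fin n) =>
      T.indicator (1 : ℝ → ℝ≥0∞) (inner ℝ p.2 v - p.1) * G p.2 :=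
    (hT.comp (by fun_prop)).mul (hG.comp measurable_snd)
  calc ∫⁻ x, F x ≤ ∫⁻ x, ∫⁻ y : ℝ, T.indicator 1 (inner ℝ x v) * G (x + y • v) := by
        refine lintegral_mono fun x => ?_
        rcases lt_or_ge ‖x‖ 1 with hx | hx
        · have : inner ℝ x v ∈ T :=
            abs_lt.1 (((abs_real_inner_le_norm x v).trans_eq (by rw [hv, mul_one])).trans_lt hx)
          simpa [indicator_of_mem this] using hFG x
        · simp [hF x hx]
    _ = ∫⁻ y : ℝ, ∫⁻ x, T.indicator 1 (inner ℝ x v) * G (x + y • v) :=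
        lintegral_lintegral_swap hm.aemeasurable
    _ = ∫⁻ y : ℝ, ∫⁻ x, T.indicator 1 (inner ℝ x v - y) * G x := by
        refine lintegral_congr fun y => ?_
        rw [← lintegral_sub_right_eq_self _ (y • v)]
        simp [inner_sub_left, inner_smul_left, hv]
    _ = ∫⁻ x, ∫⁻ y : ℝ, T.indicator 1 (inner ℝ x v - y) * G x :=
        lintegral_lintegral_swap hm'.aemeasurable
    _ = ∫⁻ x, 2 * G x := by
        refine lintegral_congr fun x => ?_
        rw [lintegral_mul_const (G x) (f := fun y => T.indicator 1 (inner ℝ x v - y))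
            (hT.comp (by fun_prop)),
          lintegral_sub_left_eq_self (T.indicator 1), lintegral_indicator_one measurableSet_Ioo,
          Real.volume_Ioo]
        norm_num
    _ = 2 * ∫⁻ x, G x := lintegral_const_mul _ hG

/-- Splits a weighted product evenly, in preparation for the Cauchy–Schwarz inequality. -/
lemma mul_ofReal_rpow_half_mul_le (w : ℝ≥0∞) {q x g s : ℝ} (hx : 0 ≤ x) (hs : g ^ 2 ≤ s) :
    w * ENNReal.ofReal (x ^ (q / 2) * g) ≤
      (w * ENNReal.ofReal (x ^ q)) ^ (1 / 2 : ℝ) * (w * ENNReal.ofReal s) ^ (1 / 2 : ℝ) := by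
  have h2 : (0 : ℝ) ≤ 1 / 2 := by norm_num
  have hw : w ^ (1 / 2 : ℝ) * w ^ (1 / 2 : ℝ) = w := by
    rw [← ENNReal.rpow_add_of_nonneg _ _ h2 h2]
    norm_num
  rw [ENNReal.mul_rpow_of_nonneg _ _ h2, ENNReal.mul_rpow_of_nonneg _ _ h2, mul_mul_mul_comm, hw,
    ENNReal.ofReal_rpow_of_nonneg (by positivity) h2,
    ENNReal.ofReal_rpow_of_nonneg ((sq_nonneg g).trans hs) h2, ← ENNReal.ofReal_mul (by positivity),
    ← Real.rpow_mul hx, mul_one_div, ← Real.sqrt_eq_rpow]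
  gcongr
  exact Real.le_sqrt_of_sq_le hs

variable {N : ℕ} {f : Space N → ℝ}

lemma measurable_edgeWeight_snd (β : ℝ) : Measurable fun p : Space N => edgeWeight β p.2 :=
  (measurable_edgeWeight β).comp measurable_snd

lemma lintegral_rpow_half_mul_le {A B : Space N → ℝ≥0∞} (hA : Measurable A) (hB : Measurable B) :
    ∫⁻ p, A p ^ (1 / 2 : ℝ) * B p ^ (1 / 2 : ℝ) ≤
      (∫⁻ p, A p) ^ (1 / 2 : ℝ) * (∫⁻ p, B p) ^ (1 / 2 : ℝ) :=
  ENNReal.lintegral_mul_norm_pow_le hA.aemeasurable hB.aemeasurable (by norm_num) (by norm_num)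
    (by norm_num)

lemma IsTestFunction.lintegral_sq_le (hN : 2 ≤ N) (hf : IsTestFunction (infiniteCylinder N) f)
    {α : ℝ} (hα : -1 < α) :
    ∫⁻ p, edgeWeight α p.2 * ENNReal.ofReal (|f p| ^ (2 : ℝ)) ≤
      16 * ∫⁻ p, edgeWeight α p.2 * ENNReal.ofReal (‖gradX f p‖ ^ 2) := by
  have hfm : Measurable f := hf.contDiff.continuous.measurable
  have hgm : Measurable (gradX f) := (continuous_gradX hf.contDiff_one).measurable
  have hw : Measurable fun p : Space N => edgeWeight α p.2 := measurable_edgeWeight_snd α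
  set X := ∫⁻ p, edgeWeight α p.2 * ENNReal.ofReal (|f p| ^ (2 : ℝ))
  set Y := ∫⁻ p, edgeWeight α p.2 * ENNReal.ofReal (‖gradX f p‖ ^ 2)
  set v : EuclideanSpace ℝ (Fin (N - 1)) := EuclideanSpace.single ⟨0, by omega⟩ 1
  have hv : ‖v‖ = 1 := by simp [v]
  set G : Space N → ℝ≥0∞ := fun p => ENNReal.ofReal (2 * |f p| ^ ((2 : ℝ) - 1) * ‖gradX f p‖)
  have hG : Measurable G := by fun_prop
  have hA : Measurable fun p => edgeWeight α p.2 * ENNReal.ofReal (|f p| ^ (2 : ℝ)) :=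
    hw.mul (by fun_prop)
  have hB : Measurable fun p => edgeWeight α p.2 * ENNReal.ofReal (‖gradX f p‖ ^ 2) :=
    hw.mul (by fun_prop)
  have h1 : X ≤ 2 * ∫⁻ p, edgeWeight α p.2 * G p := by
    simp only [X]
    rw [Measure.volume_eq_prod, lintegral_prod_symm _ hA.aemeasurable,
      lintegral_prod_symm (fun p => edgeWeight α p.2 * G p) (hw.mul hG).aemeasurable,
      ← lintegral_const_mul' _ _ ENNReal.ofNat_ne_top]
    refine lintegral_mono fun t => ?_
    simp only
    rw [lintegral_const_mul' _ _ (edgeWeight_ne_top _ _),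
      lintegral_const_mul' _ _ (edgeWeight_ne_top _ _), mul_left_comm]
    gcongr
    refine lintegral_le_two_mul_of_line_bound hv (hG.comp measurable_prodMk_right)
      (fun x => hf.abs_rpow_le_lintegral_line one_lt_two hv x t) fun x hx => ?_
    simp [hf.eq_zero (p := (x, t)) hx]
  have h2 : ∫⁻ p, edgeWeight α p.2 * G p ≤ 2 * (X ^ (1 / 2 : ℝ) * Y ^ (1 / 2 : ℝ)) := by
    refine le_trans ?_ (mul_le_mul_right (lintegral_rpow_half_mul_le hA hB) 2)
    rw [← lintegral_const_mul' _ _ ENNReal.ofNat_ne_top]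
    refine lintegral_mono fun p => ?_
    have := mul_ofReal_rpow_half_mul_le (edgeWeight α p.2) (q := 2) (abs_nonneg (f p))
      (le_refl (‖gradX f p‖ ^ 2))
    refine le_trans (le_of_eq ?_) (mul_le_mul_right this 2)
    simp only [G]
    rw [mul_assoc 2, ENNReal.ofReal_mul two_pos.le, mul_left_comm]
    norm_num
  have h3 : X ≤ (4 * (X ^ (1 / 2 : ℝ) * Y ^ (1 / 2 : ℝ))) ^ (1 : ℝ) := by
    rw [ENNReal.rpow_one]
    refine h1.trans ((mul_le_mul_right h2 2).trans_eq ?_)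
    rw [← mul_assoc]
    norm_num
  have h4 := rpow_le_mul_of_le_mul_rpow one_pos one_lt_two
    (hf.lintegral_abs_rpow_ne_top hα two_pos) h3
  norm_num at h4
  simpa [X] using h4

lemma IsTestFunction.weightedNormSq_eq (hf : IsTestFunction (infiniteCylinder N) f)
    (α : ℝ) {Q : ℝ} (hQ : 0 < Q) :
    weightedNormSq α Q f =
      (∫⁻ p, edgeWeight α p.2 * ENNReal.ofReal (|f p| ^ Q)) ^ (2 / Q) := by
  rw [weightedNormSq, setLIntegral_finiteCylinder]
  exact fun p hp => by simp [hf.eq_zero hp, hQ.ne']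

lemma IsTestFunction.anisotropicEnergy_eq (hf : IsTestFunction (infiniteCylinder N) f)
    (α σ : ℝ) :
    anisotropicEnergy α σ f = ∫⁻ p, edgeWeight α p.2 *
      ENNReal.ofReal (‖gradX f p‖ ^ 2 + (1 - |p.2|) ^ σ * |derivLam f p| ^ 2) := by
  rw [anisotropicEnergy, setLIntegral_finiteCylinder]
  exact fun p hp => by simp [hf.gradX_eq_zero hp, hf.derivLam_eq_zero hp]

lemma IsTestFunction.lintegral_sq_le_anisotropicEnergy (hN : 2 ≤ N)
    (hf : IsTestFunction (infiniteCylinder N) f) {α : ℝ} (hα : -1 < α) (σ : ℝ) :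
    ∫⁻ p, edgeWeight α p.2 * ENNReal.ofReal (|f p| ^ (2 : ℝ)) ≤ 16 * anisotropicEnergy α σ f := by
  refine (hf.lintegral_sq_le hN hα).trans ?_
  rw [hf.anisotropicEnergy_eq]
  gcongr 16 * ?_
  refine lintegral_mono fun p => ?_
  rcases lt_or_ge |p.2| 1 with h | h
  · gcongr
    have : 0 ≤ (1 - |p.2|) ^ σ := Real.rpow_nonneg (by linarith) _
    exact le_add_of_nonneg_right (by positivity)
  · simp [edgeWeight_of_le _ h]

/-! ### The inequality at the critical exponent -/

/-- The critical inequality. The `L¹` inequality is applied to `|f| ^ γ` with `γ = q / 2 + 1`, the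
exponent for which `|f| ^ (2 * (γ - 1))` and `(|f| ^ γ) ^ (D / (D - 1))` both equal `|f| ^ q`. -/
lemma exists_critical_bound (hN : 2 ≤ N) {α σ D q : ℝ} (hα : -1 < α) (hσ : -2 * α < σ)
    (hσ2 : σ < 2) (hD : D = N + (2 * α + σ) / (2 - σ)) (hq : q = 2 * D / (D - 2)) :
    ∃ C : ℝ≥0, ∀ f : Space N → ℝ, IsTestFunction (infiniteCylinder N) f →
      (∫⁻ p, edgeWeight α p.2 * ENNReal.ofReal (|f p| ^ q)) ^ (2 / q) ≤
        C * anisotropicEnergy α σ f := by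
  have hN' : (2 : ℝ) ≤ N := by exact_mod_cast hN
  have hcast : ((N - 1 : ℕ) : ℝ) = N - 1 := by
    rw [Nat.cast_sub (by omega), Nat.cast_one]
  have hσ2' : 0 < 2 - σ := by linarith
  have ha : 0 < (2 * α + σ) / (2 - σ) := div_pos (by linarith) hσ2'
  have hD2 : 0 < D - 2 := by linarith
  have hD1 : 0 < D - 1 := by linarith
  have hq0 : 0 < q := by rw [hq]; exact div_pos (by linarith) hD2
  set b : ℝ := α + σ / 2
  have hb : 0 < b := by simp only [b]; linarith
  set γ : ℝ := q / 2 + 1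
  have hγ : 1 < γ := by simp only [γ]; linarith
  have hDb : (D - (N - 1 : ℕ) - 1) * (1 + α - b) = b := by
    rw [hcast, hD]
    simp only [b]
    field_simp
    ring
  set κ : ℝ := D / (D - 1)
  have hκ0 : 0 < κ := div_pos (by linarith) hD1
  have hκ2 : κ < 2 := by rw [div_lt_iff₀ hD1]; linarith
  have hγκ : γ * κ = q := by
    simp only [γ, κ]; rw [hq]; field_simp; ring
  have hκq : 2 / κ - 1 = 2 / q := by
    have : D ≠ 0 := by linarith
    simp only [κ]; rw [hq]; field_simp; ring
  obtain ⟨C, hC⟩ := exists_edgeWeight_bounds α hb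
  set g : ℝ≥0∞ := ENNReal.ofReal γ
  set K : ℝ≥0∞ := g + C * (1 + g)
  have hg : g ≠ ⊤ := ENNReal.ofReal_ne_top
  have hK : K ≠ ⊤ := by finiteness
  have hK17 : K ^ 2 * 17 ≠ ⊤ := by finiteness
  refine ⟨(K ^ 2 * 17).toNNReal, fun f hf => ?_⟩
  rw [ENNReal.coe_toNNReal hK17]
  have hfm : Measurable f := hf.contDiff.continuous.measurable
  have hgm : Measurable (gradX f) := (continuous_gradX hf.contDiff_one).measurable
  have hlm : Measurable (derivLam f) := (continuous_derivLam hf.contDiff_one).measurable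
  have hw : Measurable fun p : Space N => edgeWeight α p.2 := measurable_edgeWeight_snd α
  set S : Space N → ℝ := fun p =>
    ‖gradX f p‖ ^ 2 + (1 - |p.2|) ^ σ * |derivLam f p| ^ 2 + |f p| ^ (2 : ℝ)
  set A : Space N → ℝ≥0∞ := fun p => edgeWeight α p.2 * ENNReal.ofReal (|f p| ^ q)
  set B : Space N → ℝ≥0∞ := fun p => edgeWeight α p.2 * ENNReal.ofReal (S p)
  have hA : Measurable A := hw.mul (by fun_prop)
  have hB : Measurable B := hw.mul (by fun_prop)
  -- `φ` dominates every term of the `L¹` energy of `|f| ^ γ`, and its integral is at most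
  -- `(∫ A) ^ (1 / 2) * (∫ B) ^ (1 / 2)`.
  set φ : Space N → ℝ≥0∞ := fun p => A p ^ (1 / 2 : ℝ) * B p ^ (1 / 2 : ℝ)
  have hφ : Measurable φ := (hA.pow_const _).mul (hB.pow_const _)
  have hpt : ∀ p (c : ℝ), (|p.2| < 1 → c ^ 2 ≤ S p) →
      edgeWeight α p.2 * ENNReal.ofReal (|f p| ^ (q / 2) * c) ≤ φ p := by
    intro p c hcS
    rcases lt_or_ge |p.2| 1 with h | h
    · exact mul_ofReal_rpow_half_mul_le _ (abs_nonneg _) (hcS h)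
    · simp [edgeWeight_of_le _ h]
  have hS : ∀ p : Space N, |p.2| < 1 → 0 ≤ (1 - |p.2|) ^ σ * |derivLam f p| ^ 2 :=
    fun p h => mul_nonneg (Real.rpow_nonneg (by linarith) _) (by positivity)
  have hgrad : ∀ p, edgeWeight α p.2 *
      ENNReal.ofReal (γ * |f p| ^ (γ - 1) * ‖gradX f p‖) ≤ g * φ p := by
    intro p
    rw [mul_assoc γ, ENNReal.ofReal_mul (by linarith), mul_left_comm,
      show γ - 1 = q / 2 by simp only [γ]; ring]
    gcongr g * ?_
    refine hpt p _ fun h => ?_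
    have := hS p h
    have : 0 ≤ |f p| ^ (2 : ℝ) := by positivity
    simp only [S]; linarith
  have hzero : ∀ p, edgeWeight α p.2 * ENNReal.ofReal (|f p| ^ γ) ≤ φ p := by
    intro p
    rw [Real.rpow_add_of_nonneg (abs_nonneg _) (by positivity) zero_le_one, Real.rpow_one]
    refine hpt p _ fun h => ?_
    have := hS p h
    simp only [S]
    rw [Real.rpow_two]
    have : 0 ≤ ‖gradX f p‖ ^ 2 := by positivity
    linarith
  have hlam : ∀ p, edgeWeight b p.2 *
      ENNReal.ofReal (γ * |f p| ^ (γ - 1) * |derivLam f p|) ≤ g * φ p := by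
    intro p
    rcases lt_or_ge |p.2| 1 with h | h
    swap
    · simp [edgeWeight_of_le _ h]
    have hs : 0 < 1 - |p.2| := by linarith
    rw [mul_assoc γ, ENNReal.ofReal_mul (by linarith), mul_left_comm,
      show γ - 1 = q / 2 by simp only [γ]; ring]
    gcongr g * ?_
    rw [edgeWeight_add, edgeWeight_of_lt (σ / 2) h, mul_assoc,
      ← ENNReal.ofReal_mul (Real.rpow_nonneg hs.le _), mul_left_comm]
    refine hpt p _ fun _ => ?_
    rw [mul_pow, ← Real.rpow_natCast, ← Real.rpow_mul hs.le]
    have h1 : σ / 2 * (2 : ℕ) = σ := by push_cast; ring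
    rw [h1]
    have h2 : 0 ≤ ‖gradX f p‖ ^ 2 := by positivity
    have h3 : 0 ≤ |f p| ^ (2 : ℝ) := by positivity
    simp only [S]; linarith
  set F : Space N → ℝ≥0∞ := fun p => ENNReal.ofReal (|f p| ^ γ)
  have hF : Measurable F := by fun_prop
  have hline : ∀ x, (∫⁻ t, edgeWeight α t * F (x, t)) + ∫⁻ t, edgeWeight b t *
      ENNReal.ofReal (γ * |f (x, t)| ^ (γ - 1) * |derivLam f (x, t)|) ≤
        (1 + g) * ∫⁻ r, φ (x, r) := by
    intro x
    rw [add_mul, one_mul, ← lintegral_const_mul' g _ hg]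
    exact add_le_add (lintegral_mono fun t => hzero (x, t)) (lintegral_mono fun t => hlam (x, t))
  have hup : ∀ x, IsUpperGradient (fun t => F (x, t))
      fun t => ENNReal.ofReal (γ * |f (x, t)| ^ (γ - 1) * |derivLam f (x, t)|) := fun x =>
    isUpperGradient_abs_rpow (hf.contDiff_one.comp (contDiff_const.prodMk contDiff_id)) hγ
  have hum : ∀ x, Measurable fun t =>
      ENNReal.ofReal (γ * |f (x, t)| ^ (γ - 1) * |derivLam f (x, t)|) := fun x =>
    (show Measurable fun p => ENNReal.ofReal (γ * |f p| ^ (γ - 1) * |derivLam f p|) by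
      fun_prop).comp measurable_prodMk_left
  have hCK : ∀ x, C * ((1 + g) * ∫⁻ r, φ (x, r)) ≤ ∫⁻ r, K * φ (x, r) := by
    intro x
    rw [lintegral_const_mul' _ _ hK, ← mul_assoc]
    exact mul_le_mul_left le_add_self _
  have hL1 : ∫⁻ p, edgeWeight α p.2 * F p ^ κ ≤ (∫⁻ p, K * φ p) ^ κ := by
    refine lintegral_edgeWeight_mul_rpow_le (by omega) (by rw [hcast]; linarith) hDb
      (hφ.const_mul K) hF (fun i x t => ?_) (fun x t => ?_) fun x => ?_
    · refine (mul_le_mul_right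
        (hf.abs_rpow_le_lintegral_line hγ
          (v := EuclideanSpace.single i 1) (by simp) x t) (edgeWeight α t)).trans ?_
      rw [← lintegral_const_mul' _ _ (edgeWeight_ne_top _ _)]
      refine lintegral_mono fun y => (hgrad (_, t)).trans ?_
      exact mul_le_mul_left le_self_add _
    · exact ((hC _ _ (hup x) (hum x)).1 t).trans
        ((mul_le_mul_right (hline x) _).trans (hCK x))
    · exact (hC _ _ (hup x) (hum x)).2.trans
        ((mul_le_mul_right (hline x) _).trans (hCK x))
  have hFκ : ∀ p, F p ^ κ = ENNReal.ofReal (|f p| ^ q) := fun p => by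
    rw [ENNReal.ofReal_rpow_of_nonneg (by positivity) hκ0.le, ← Real.rpow_mul (abs_nonneg _), hγκ]
  simp only [hFκ] at hL1
  have hL2 : ∫⁻ p, A p ≤
      (K * ((∫⁻ p, A p) ^ (1 / 2 : ℝ) * (∫⁻ p, B p) ^ (1 / 2 : ℝ))) ^ κ := by
    refine hL1.trans ?_
    rw [lintegral_const_mul' _ _ hK]
    gcongr
    exact lintegral_rpow_half_mul_le hA hB
  -- `17 = 1 + 16`, where `16` is the constant in the Poincaré inequality.
  have hBE : ∫⁻ p, B p ≤ 17 * anisotropicEnergy α σ f := by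
    have hsplit : ∀ p, B p ≤ edgeWeight α p.2 *
        ENNReal.ofReal (‖gradX f p‖ ^ 2 + (1 - |p.2|) ^ σ * |derivLam f p| ^ 2) +
        edgeWeight α p.2 * ENNReal.ofReal (|f p| ^ (2 : ℝ)) := fun p => by
      rw [← mul_add]
      exact mul_le_mul_right ENNReal.ofReal_add_le _
    have hE : Measurable fun p => edgeWeight α p.2 *
        ENNReal.ofReal (‖gradX f p‖ ^ 2 + (1 - |p.2|) ^ σ * |derivLam f p| ^ 2) :=
      hw.mul (by fun_prop)
    refine (lintegral_mono hsplit).trans ?_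
    rw [lintegral_add_left hE, ← hf.anisotropicEnergy_eq]
    refine (add_le_add_right (hf.lintegral_sq_le_anisotropicEnergy hN hα σ) _).trans_eq ?_
    ring
  have h := rpow_le_mul_of_le_mul_rpow hκ0 hκ2 (hf.lintegral_abs_rpow_ne_top hα hq0) hL2
  rw [hκq] at h
  refine h.trans ?_
  rw [mul_assoc]
  gcongr

theorem exists_sobolevInequality_of_le_criticalExponent (hN : 2 ≤ N) {α σ Q : ℝ} (hα : -1 < α)
    (hσ : -2 * α < σ) (hσ2 : σ < 2) (hQ : 2 ≤ Q) (hQc : Q ≤ criticalExponent N α σ) :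
    ∃ C : ℝ, 0 < C ∧ ∀ f : Space N → ℝ, IsTestFunction (infiniteCylinder N) f →
      SobolevInequality α σ Q C f := by
  have hQ0 : 0 < Q := by linarith
  obtain ⟨C₁, h₁⟩ := exists_critical_bound hN hα hσ hσ2 rfl
    (show criticalExponent N α σ = _ from rfl)
  obtain ⟨C₂, h₂⟩ := IsTestFunction.exists_rpow_le_rpow (N := N) hα hQ0 hQc
  refine ⟨C₂ * C₁ + 1, by positivity, fun f hf => ?_⟩
  rw [SobolevInequality, hf.weightedNormSq_eq α hQ0]
  refine ((h₂ f hf).trans (mul_le_mul_right (h₁ f hf) _)).trans ?_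
  rw [← mul_assoc]
  gcongr
  rw [← ENNReal.coe_mul, ← NNReal.coe_mul, ← ENNReal.ofReal_coe_nnreal]
  exact ENNReal.ofReal_le_ofReal (by linarith)

theorem exists_sobolevInequality_two (hN : 2 ≤ N) {α : ℝ} (hα : -1 < α) :
    ∃ C : ℝ, 0 < C ∧ ∀ f : Space N → ℝ, IsTestFunction (infiniteCylinder N) f →
      SobolevInequality α 2 2 C f := by
  refine ⟨16, by norm_num, fun f hf => ?_⟩
  rw [SobolevInequality, hf.weightedNormSq_eq α two_pos, div_self two_ne_zero, ENNReal.rpow_one,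
    ENNReal.ofReal_ofNat]
  exact hf.lintegral_sq_le_anisotropicEnergy hN hα 2

end AnisotropicSobolev

namespace AnisotropicSobolev

/-! ### Concentration at the edge for `σ = 2` -/

variable {N : ℕ}

/-- The profile `g` compressed towards the face `lam = 1` by the factor `ε`. -/
noncomputable def compress (ε : ℝ) (g : Space N → ℝ) (p : Space N) : ℝ := g (p.1, 1 - (1 - p.2) / ε)

lemma lintegral_compress {ε : ℝ} (hε : 0 < ε) {H : Space N → ℝ≥0∞} (hH : Measurable H) :
    ∫⁻ p : Space N, H (p.1, 1 - (1 - p.2) / ε) = ENNReal.ofReal ε * ∫⁻ p, H p := by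
  have hm : Measurable fun p : Space N => H (p.1, 1 - (1 - p.2) / ε) := hH.comp (by fun_prop)
  rw [Measure.volume_eq_prod, lintegral_prod _ hm.aemeasurable, lintegral_prod _ hH.aemeasurable,
    ← lintegral_const_mul' _ _ ENNReal.ofReal_ne_top]
  refine lintegral_congr fun x => ?_
  have hx : Measurable fun t : ℝ => H (x, t) := hH.comp measurable_prodMk_left
  have hx' : Measurable fun t : ℝ => H (x, 1 - t / ε) := hx.comp (by fun_prop)
  calc ∫⁻ t : ℝ, H (x, 1 - (1 - t) / ε) = ∫⁻ t : ℝ, H (x, 1 - t / ε) :=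
        lintegral_sub_left_eq_self (fun t => H (x, 1 - t / ε)) 1
    _ = ENNReal.ofReal ε * ∫⁻ t : ℝ, H (x, 1 - t) := by
        conv_lhs => rw [← Real.smul_map_volume_mul_left hε.ne']
        rw [lintegral_smul_measure, lintegral_map hx' (by fun_prop), abs_of_pos hε, smul_eq_mul]
        simp [mul_div_cancel_left₀ _ hε.ne']
    _ = ENNReal.ofReal ε * ∫⁻ t : ℝ, H (x, t) := by
        rw [lintegral_sub_left_eq_self (fun t => H (x, t)) 1]

/-- The weight is homogeneous under compression, for integrands living on `0 < lam < 1`. -/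
lemma edgeWeight_mul_compress {α ε : ℝ} (hε : 0 < ε) (hε1 : ε ≤ 1) {t : ℝ} {X Y : ℝ≥0∞}
    (hXY : 0 < 1 - (1 - t) / ε → 1 - (1 - t) / ε < 1 → X = Y)
    (hX : ¬(0 < 1 - (1 - t) / ε ∧ 1 - (1 - t) / ε < 1) → X = 0)
    (hY : ¬(0 < 1 - (1 - t) / ε ∧ 1 - (1 - t) / ε < 1) → Y = 0) :
    edgeWeight α t * X = ENNReal.ofReal (ε ^ α) * (edgeWeight α (1 - (1 - t) / ε) * Y) := by
  by_cases h : 0 < 1 - (1 - t) / ε ∧ 1 - (1 - t) / ε < 1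
  · have h1 : (1 - t) / ε < 1 := by linarith [h.1]
    have h2 : 0 < (1 - t) / ε := by linarith [h.2]
    have h3 : 1 - t < ε := by rwa [div_lt_one hε] at h1
    have h4 : 0 < 1 - t := by rwa [div_pos_iff_of_pos_right hε] at h2
    have ht : |t| = t := abs_of_nonneg (by linarith)
    rw [hXY h.1 h.2, edgeWeight_of_lt _ (by rw [ht]; linarith),
      edgeWeight_of_lt _ (by rw [abs_of_pos h.1]; exact h.2), ht, abs_of_pos h.1, ← mul_assoc,
      ← ENNReal.ofReal_mul (by positivity), sub_sub_cancel,
      ← Real.mul_rpow hε.le h2.le, mul_div_cancel₀ _ hε.ne']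
  · rw [hX h, hY h]; simp

lemma derivLam_compress {g : Space N → ℝ} (hg : ContDiff ℝ 1 g) (ε : ℝ) (p : Space N) :
    derivLam (compress ε g) p = derivLam g (p.1, 1 - (1 - p.2) / ε) / ε := by
  have h1 : HasDerivAt (fun t : ℝ => 1 - (1 - t) / ε) (1 / ε) p.2 := by
    simpa [neg_div] using (((hasDerivAt_id p.2).const_sub 1).div_const ε).const_sub 1
  have h2 := (hasDerivAt_derivLam hg (p.1, 1 - (1 - p.2) / ε)).comp p.2 h1
  rw [mul_one_div] at h2
  exact h2.deriv

lemma IsTestFunction.compress {ε : ℝ} (hε : 0 < ε) (hε1 : ε ≤ 1) {g : Space N → ℝ}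
    (hg : ContDiff ℝ ∞ g)
    (hs : tsupport g ⊆ Metric.closedBall 0 (1 / 4) ×ˢ Icc (1 / 4) (3 / 4)) :
    IsTestFunction (finiteCylinder N) (compress ε g) := by
  set K : Set (Space N) := Metric.closedBall 0 (1 / 4) ×ˢ Icc (1 - 3 / 4 * ε) (1 - 1 / 4 * ε)
  have hK : IsCompact K := (isCompact_closedBall _ _).prod isCompact_Icc
  have hsub : Function.support (AnisotropicSobolev.compress ε g) ⊆ K := by
    intro p hp
    have h := hs (subset_tsupport g hp)
    refine ⟨h.1, ?_, ?_⟩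
    · have h1 : (1 - p.2) / ε ≤ 3 / 4 := by linarith [h.2.1]
      rw [div_le_iff₀ hε] at h1; linarith
    · have h1 : 1 / 4 ≤ (1 - p.2) / ε := by linarith [h.2.2]
      rw [le_div_iff₀ hε] at h1; linarith
  refine ⟨hg.comp ?_, HasCompactSupport.of_support_subset_isCompact hK hsub,
    (closure_minimal hsub hK.isClosed).trans fun p hp => ⟨?_, ?_⟩⟩
  · fun_prop
  · have := hp.1
    rw [mem_closedBall_zero_iff] at this
    linarith
  · rw [abs_lt]
    constructor <;> linarith [hp.2.1, hp.2.2]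

lemma IsTestFunction.mono {U V : Set (Space N)} {f : Space N → ℝ} (hf : IsTestFunction U f)
    (h : U ⊆ V) : IsTestFunction V f :=
  ⟨hf.contDiff, hf.hasCompactSupport, hf.tsupport_subset.trans h⟩

lemma finiteCylinder_subset : finiteCylinder N ⊆ infiniteCylinder N := fun _ h => h.1

/-- Test functions of the finite cylinder stay away from the edge, where the weights may be
singular, so their energy is finite. -/
lemma IsTestFunction.anisotropicEnergy_ne_top {f : Space N → ℝ}
    (hf : IsTestFunction (finiteCylinder N) f) (α σ : ℝ) : anisotropicEnergy α σ f ≠ ⊤ := by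
  set h : Space N → ℝ := fun p =>
    (1 - |p.2|) ^ α * (‖gradX f p‖ ^ 2 + (1 - |p.2|) ^ σ * |derivLam f p| ^ 2)
  have hpow : ∀ β : ℝ, ContinuousOn (fun p : Space N => (1 - |p.2|) ^ β) (tsupport f) := by
    intro β p hp
    have : 0 < 1 - |p.2| := sub_pos.2 (hf.tsupport_subset hp).2
    have hcont : ContinuousAt (fun p : Space N => 1 - |p.2|) p := by fun_prop
    exact (hcont.rpow_const (Or.inl this.ne')).continuousWithinAt
  have hc : ContinuousOn h (tsupport f) :=
    (hpow α).mul (((continuous_gradX hf.contDiff_one).norm.pow 2).continuousOn.add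
      ((hpow σ).mul ((continuous_derivLam hf.contDiff_one).abs.pow 2).continuousOn))
  have hint : IntegrableOn h (tsupport f) := hc.integrableOn_compact hf.hasCompactSupport
  refine ne_top_of_le_ne_top (Integrable.lintegral_lt_top hint).ne ?_
  rw [anisotropicEnergy, ← lintegral_indicator (isClosed_tsupport f).measurableSet]
  refine (setLIntegral_le_lintegral _ _).trans (lintegral_mono fun p => ?_)
  by_cases hp : p ∈ tsupport f
  · rw [indicator_of_mem hp]
  · simp [gradX_eq_zero_of_notMem_tsupport hp, derivLam_eq_zero_of_notMem_tsupport hp]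

/-- For `σ = 2` both sides are homogeneous under compression, of different degrees unless
`Q = 2`. -/
theorem not_exists_sobolevInequality_two {α Q : ℝ} (hα : -1 < α) (hQ : 2 < Q) :
    ¬ ∃ C : ℝ, 0 < C ∧ ∀ f : Space N → ℝ, IsTestFunction (finiteCylinder N) f →
      SobolevInequality α 2 Q C f := by
  rintro ⟨C, -, hC⟩
  have hQ0 : 0 < Q := by linarith
  let χ : ContDiffBump ((0, 1 / 2) : Space N) := ⟨1 / 8, 1 / 4, by norm_num, by norm_num⟩
  set g : Space N → ℝ := fun p => χ p
  have hg : ContDiff ℝ ∞ g := χ.contDiff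
  have hg1 : ContDiff ℝ 1 g := χ.contDiff
  have hs : tsupport g ⊆ Metric.closedBall 0 (1 / 4) ×ˢ Icc (1 / 4) (3 / 4) := by
    rw [χ.tsupport_eq, ← closedBall_prod_same, Real.closedBall_eq_Icc]
    exact prod_mono subset_rfl (Icc_subset_Icc (by norm_num [χ]) (by norm_num [χ]))
  have hsupp : ∀ p : Space N, ¬(0 < p.2 ∧ p.2 < 1) → p ∉ tsupport g := fun p hp h =>
    hp ⟨by linarith [(hs h).2.1], by linarith [(hs h).2.2]⟩
  have hgm : Measurable g := hg.continuous.measurable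
  have hxm : Measurable (gradX g) := (continuous_gradX hg1).measurable
  have hlm : Measurable (derivLam g) := (continuous_derivLam hg1).measurable
  have hone : compress 1 g = g := by
    ext p; simp [compress]
  have htest : ∀ ε : ℝ, 0 < ε → ε ≤ 1 → IsTestFunction (finiteCylinder N) (compress ε g) :=
    fun ε h0 h1 => .compress h0 h1 hg hs
  have htest1 : IsTestFunction (finiteCylinder N) g := hone ▸ htest 1 one_pos le_rfl
  set J := ∫⁻ p, edgeWeight α p.2 * ENNReal.ofReal (|g p| ^ Q)
  set E := anisotropicEnergy α 2 g
  have hE : E ≠ ⊤ := htest1.anisotropicEnergy_ne_top α 2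
  have hJ : J ≠ 0 := by
    have hJm : Measurable fun p : Space N => edgeWeight α p.2 * ENNReal.ofReal (|g p| ^ Q) :=
      (measurable_edgeWeight_snd α).mul (by fun_prop)
    refine ((lintegral_pos_iff_support hJm).2 ?_).ne'
    refine (Metric.measure_ball_pos volume ((0, 1 / 2) : Space N) χ.rOut_pos).trans_le
      (measure_mono fun p hp => ?_)
    have h1 : 0 < g p := χ.pos_of_mem_ball hp
    have h2 : |p.2| < 1 := (htest1.tsupport_subset (subset_tsupport g h1.ne')).2
    rw [Function.mem_support, edgeWeight_of_lt _ h2]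
    have h3 : 0 < 1 - |p.2| := by linarith
    exact mul_ne_zero (ENNReal.ofReal_pos.2 (by positivity)).ne'
      (ENNReal.ofReal_pos.2 (Real.rpow_pos_of_pos (abs_pos.2 h1.ne') _)).ne'
  have hnorm : ∀ ε : ℝ, 0 < ε → ε ≤ 1 → weightedNormSq α Q (compress ε g) =
      (ENNReal.ofReal (ε ^ (α + 1)) * J) ^ (2 / Q) := by
    intro ε h0 h1
    rw [((htest ε h0 h1).mono finiteCylinder_subset).weightedNormSq_eq α hQ0]
    congr 1
    rw [lintegral_congr (g := fun p => ENNReal.ofReal (ε ^ α) *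
      (edgeWeight α (1 - (1 - p.2) / ε) * ENNReal.ofReal (|g (p.1, 1 - (1 - p.2) / ε)| ^ Q)))]
    · rw [lintegral_const_mul' _ _ ENNReal.ofReal_ne_top, lintegral_compress h0
        (H := fun p => edgeWeight α p.2 * ENNReal.ofReal (|g p| ^ Q))
        ((measurable_edgeWeight_snd α).mul (by fun_prop)), ← mul_assoc,
        ← ENNReal.ofReal_mul (by positivity), ← Real.rpow_add_one h0.ne']
    · intro p
      have hz : ¬(0 < 1 - (1 - p.2) / ε ∧ 1 - (1 - p.2) / ε < 1) →
          ENNReal.ofReal (|g (p.1, 1 - (1 - p.2) / ε)| ^ Q) = 0 := fun h => by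
        rw [image_eq_zero_of_notMem_tsupport (hsupp (p.1, _) h)]
        simp [hQ0.ne']
      exact edgeWeight_mul_compress h0 h1 (fun _ _ => rfl) hz hz
  have henergy : ∀ ε : ℝ, 0 < ε → ε ≤ 1 → anisotropicEnergy α 2 (compress ε g) =
      ENNReal.ofReal (ε ^ (α + 1)) * E := by
    intro ε h0 h1
    simp only [E]
    rw [((htest ε h0 h1).mono finiteCylinder_subset).anisotropicEnergy_eq,
      (htest1.mono finiteCylinder_subset).anisotropicEnergy_eq]
    set H : Space N → ℝ≥0∞ := fun p =>
      ENNReal.ofReal (‖gradX g p‖ ^ 2 + (1 - |p.2|) ^ (2 : ℝ) * |derivLam g p| ^ 2)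
    have hH : Measurable H := by fun_prop
    rw [lintegral_congr (g := fun p => ENNReal.ofReal (ε ^ α) *
      (edgeWeight α (1 - (1 - p.2) / ε) * H (p.1, 1 - (1 - p.2) / ε)))]
    · rw [lintegral_const_mul' _ _ ENNReal.ofReal_ne_top, lintegral_compress h0
        (H := fun p => edgeWeight α p.2 * H p)
        ((measurable_edgeWeight_snd α).mul hH), ← mul_assoc,
        ← ENNReal.ofReal_mul (by positivity), ← Real.rpow_add_one h0.ne']
    · intro p
      have hx : gradX (compress ε g) p = gradX g (p.1, 1 - (1 - p.2) / ε) := rfl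
      refine edgeWeight_mul_compress h0 h1 (fun h2 h3 => ?_) (fun h => ?_) fun h => ?_
      · have h4 : 1 - p.2 < ε := by
          rw [sub_pos, div_lt_one h0] at h2; exact h2
        simp only [H]
        rw [hx, derivLam_compress hg1, abs_of_pos h2, sub_sub_cancel, Real.rpow_two, Real.rpow_two,
          abs_of_nonneg (by linarith : 0 ≤ p.2), sq_abs, sq_abs]
        congr 2
        field_simp
      · rw [hx, derivLam_compress hg1, gradX_eq_zero_of_notMem_tsupport (hsupp (p.1, _) h),
          derivLam_eq_zero_of_notMem_tsupport (hsupp (p.1, _) h)]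
        simp
      · simp only [H]
        rw [gradX_eq_zero_of_notMem_tsupport (hsupp (p.1, _) h),
          derivLam_eq_zero_of_notMem_tsupport (hsupp (p.1, _) h)]
        simp
  -- The two degrees of homogeneity differ by `δ > 0`.
  set δ : ℝ := (α + 1) * (1 - 2 / Q)
  have hδ : 0 < δ := mul_pos (by linarith) (by rw [sub_pos, div_lt_one hQ0]; exact hQ)
  have hbound : ∀ ε : ℝ, 0 < ε → ε ≤ 1 →
      J ^ (2 / Q) ≤ ENNReal.ofReal C * E * ENNReal.ofReal (ε ^ δ) := by
    intro ε h0 h1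
    have h := hC _ (htest ε h0 h1)
    rw [SobolevInequality, hnorm ε h0 h1, henergy ε h0 h1,
      ENNReal.mul_rpow_of_nonneg _ _ (by positivity),
      ENNReal.ofReal_rpow_of_nonneg (by positivity) (by positivity), ← Real.rpow_mul h0.le] at h
    have hne : ENNReal.ofReal (ε ^ ((α + 1) * (2 / Q))) ≠ 0 :=
      (ENNReal.ofReal_pos.2 (by positivity)).ne'
    rw [← ENNReal.mul_le_mul_iff_right hne ENNReal.ofReal_ne_top]
    refine h.trans_eq ?_
    have hexp : α + 1 = (α + 1) * (2 / Q) + δ := by simp only [δ]; ring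
    conv_lhs => rw [hexp, Real.rpow_add h0, ENNReal.ofReal_mul (by positivity)]
    ring
  have hlim : Filter.Tendsto (fun ε : ℝ => ENNReal.ofReal C * E * ENNReal.ofReal (ε ^ δ))
      (nhdsWithin 0 (Ioi 0)) (nhds 0) := by
    have h1 : Filter.Tendsto (fun ε : ℝ => ε ^ δ) (nhdsWithin 0 (Ioi 0)) (nhds 0) := by
      have := (Real.continuousAt_rpow_const 0 δ (Or.inr hδ.le)).tendsto
      rw [Real.zero_rpow hδ.ne'] at this
      exact this.mono_left nhdsWithin_le_nhds
    have h2 := ENNReal.Tendsto.const_mul (ENNReal.tendsto_ofReal h1)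
      (Or.inr (ENNReal.mul_ne_top (ENNReal.ofReal_ne_top (r := C)) hE))
    simpa using h2
  have h0 : J ^ (2 / Q) ≤ 0 := by
    refine ge_of_tendsto hlim ?_
    filter_upwards [Ioc_mem_nhdsGT (zero_lt_one' ℝ)] with ε hε using hbound ε hε.1 hε.2
  exact hJ ((ENNReal.rpow_eq_zero_iff_of_pos (by positivity)).1 (le_zero_iff.1 h0))

end AnisotropicSobolev

theorem theorem1p1 (N : ℕ) (hN : 2 ≤ N) (α : ℝ) (hα : -1 < α) :
    (∀ σ : ℝ, -2 * α < σ → σ < 2 →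
      ∀ Q : ℝ, 2 ≤ Q → Q ≤ AnisotropicSobolev.criticalExponent N α σ →
        ∃ C : ℝ, 0 < C ∧ ∀ f : AnisotropicSobolev.Space N → ℝ,
          AnisotropicSobolev.IsTestFunction (AnisotropicSobolev.infiniteCylinder N) f →
            AnisotropicSobolev.SobolevInequality α σ Q C f) ∧
    (∃ C : ℝ, 0 < C ∧ ∀ f : AnisotropicSobolev.Space N → ℝ,
      AnisotropicSobolev.IsTestFunction (AnisotropicSobolev.infiniteCylinder N) f →
        AnisotropicSobolev.SobolevInequality α 2 2 C f) ∧
    (∀ Q : ℝ, 2 < Q →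
      ¬ ∃ C : ℝ, 0 < C ∧ ∀ f : AnisotropicSobolev.Space N → ℝ,
        AnisotropicSobolev.IsTestFunction (AnisotropicSobolev.finiteCylinder N) f →
          AnisotropicSobolev.SobolevInequality α 2 Q C f) :=
  ⟨fun _ hσ hσ2 _ hQ hQc =>
    AnisotropicSobolev.exists_sobolevInequality_of_le_criticalExponent hN hα hσ hσ2 hQ hQc,
    AnisotropicSobolev.exists_sobolevInequality_two hN hα,
    fun _ hQ => AnisotropicSobolev.not_exists_sobolevInequality_two hα hQ⟩
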